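/- Let $k$ be a field and let $A$ be a finite-dimensional quasi-triangular quasi-Hopf algebra over $k$, with coproduct $\Delta$, counit $\varepsilon$, antipode $S$, invertible coassociator $\Phi\in A^{\otimes 3}$ satisfying $(\Delta\otimes\mathrm{id})(\Delta(a))\,\Phi=\Phi\,(\mathrm{id}\otimes\Delta)(\Delta(a))$ and $(\mathrm{id}\otimes\varepsilon\otimes\mathrm{id})(\Phi)=1\otimes 1$, evaluation and coevaluation elements $\alpha,\beta\in A$, and universal $R$-matrix $R\in A\otimes A$. Write $\Delta(a)=\sum a'\otimes a''$, write the components of an element of $A^{\otimes n}$ with lower indices, let $\tilde R$ be a copy of $R$, and set $$p=\sum \Phi_1\otimes\Phi_2\,\beta\, S(\Phi_3),\qquad \tilde q=\sum S(\Phi_1)\,\alpha\,\Phi_2\otimes\Phi_3,$$ $$M^{BT}=\sum \tilde q_1(\Phi^{-1})_1R_2\tilde R_1p_1\otimes \tilde q_2{}'(\Phi^{-1})_2R_1\tilde R_2p_2\,S\big(\tilde q_2{}''(\Phi^{-1})_3\big)\in A\otimes A.$$ Let $\mathrm{Rep}\,A$ be the category of finite-dimensional $A$-modules, with the following structure. The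 action of $A$ on $U\otimes V$ is through $\Delta$, the tensor unit is $k$ with action through $\varepsilon$, the unit isomorphisms are those of vector spaces, the associator $U\otimes(V\otimes W)\to(U\otimes V)\otimes W$ is the action of $\Phi$, and the braiding is $c_{U,V}(u\otimes v)=\tau(R\cdot(u\otimes v))$, where $\tau$ is the flip. The dual $U^*$ has action $(a f)(u)=f(S(a)u)$, evaluation $\mathrm{ev}_U:U^*\otimes U\to k$, $f\otimes u\mapsto f(\alpha u)$, and coevaluation $\mathrm{coev}_U:k\to U\otimes U^*$, $1\mapsto\sum_i\beta u_i\otimes u_i^*$. Then the linear map $$Q^{BT}:A^*\to A,\qquad \phi\mapsto(\phi\otimes\mathrm{id})(M^{BT}),$$ is bijective if and only if $\mathrm{Rep}\,A$ is factorisable. The latter means the following. Let $\mathcal L=\int^{U\in\mathrm{Rep}\,A}U^*\otimes U$ be the coend, with universal dinatural family $\iota_U:U^*\otimes U\to\mathcal L$, and let $\omega_{\mathcal L}:\mathcal L\otimes\mathcal L\to k$ be the pairing such that, for all $U,V$, the morphism $\omega_{\mathcal L}\circ(\iota_U\otimes\iota_V)$ is (up to associators and unit isomorphisms) the double braiding $\mathrm{id}_{U^*}\otimes(c_{V^*,U}\circ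 c_{U,V^*})\otimes\mathrm{id}_V$ on $U^*\otimes U\otimes V^*\otimes V$ followed by $\mathrm{id}_{U^*\otimes U}\otimes\mathrm{ev}_V$ and then $\mathrm{ev}_U$. Then $\mathrm{Rep}\,A$ is factorisable if the morphism $\mathcal L\to\mathcal L^*$ defined as $\mathrm{id}_{\mathcal L}\otimes\mathrm{coev}_{\mathcal L}$ followed by $\omega_{\mathcal L}\otimes\mathrm{id}_{\mathcal L^*}$ (up to associators and unit isomorphisms) is an isomorphism. -/

import Mathlib

universe u v w

namespace QuasiHopf

open TensorProduct

section Elements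

variable {k : Type u} {A : Type v} [Field k] [Ring A] [Algebra k A]

/-- `(Δ ⊗ id) : A ⊗ B → A ⊗ (A ⊗ B)` for an algebra homomorphism `Δ : A → A ⊗ A`. -/
noncomputable def comulLeft (D : A →ₐ[k] A ⊗[k] A) (B : Type w) [Ring B] [Algebra k B] :
    A ⊗[k] B →ₐ[k] A ⊗[k] (A ⊗[k] B) :=
  (Algebra.TensorProduct.assoc k k k A A B).toAlgHom.comp
    (Algebra.TensorProduct.map D (AlgHom.id k B))

/-- `(id ⊗ f) : A ⊗ B → A ⊗ C` for an algebra homomorphism `f : B → C`. -/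
noncomputable def idTensor (A : Type v) [Ring A] [Algebra k A] {B C : Type*} [Ring B] [Algebra k B]
    [Ring C] [Algebra k C] (f : B →ₐ[k] C) : A ⊗[k] B →ₐ[k] A ⊗[k] C :=
  Algebra.TensorProduct.map (AlgHom.id k A) f

/-- The linear map `x ⊗ y ↦ S(x) α y`. -/
noncomputable def evalMap (S : A →ₗ[k] A) (α : A) : A ⊗[k] A →ₗ[k] A :=
  LinearMap.mul' k A ∘ₗ TensorProduct.map (LinearMap.mulRight k α ∘ₗ S) LinearMap.id

/-- The linear map `x ⊗ y ↦ x β S(y)`. -/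
noncomputable def coevalMap (S : A →ₗ[k] A) (β : A) : A ⊗[k] A →ₗ[k] A :=
  LinearMap.mul' k A ∘ₗ TensorProduct.map (LinearMap.mulRight k β) S

@[simp] lemma evalMap_tmul (S : A →ₗ[k] A) (α x y : A) :
    evalMap S α (x ⊗ₜ y) = S x * α * y := by simp [evalMap]

@[simp] lemma coevalMap_tmul (S : A →ₗ[k] A) (β x y : A) :
    coevalMap S β (x ⊗ₜ y) = x * β * S y := by simp [coevalMap]

end Elements

/-- A quasi-Hopf algebra over the field `k` (with trivial unit constraints).
The coassociator `Φ` is a unit of `A ⊗ A ⊗ A`. -/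
class QuasiHopfAlgebra (k : Type u) (A : Type v) [Field k] [Ring A] [Algebra k A] where
  /-- the coproduct `Δ` -/
  comul : A →ₐ[k] A ⊗[k] A
  /-- the counit `ε` -/
  counit : A →ₐ[k] k
  /-- the antipode `S` -/
  antipode : A →ₗ[k] A
  /-- the coassociator `Φ` -/
  coassociator : (A ⊗[k] (A ⊗[k] A))ˣ
  /-- the evaluation element `α` -/
  evalElt : A
  /-- the coevaluation element `β` -/
  coevalElt : A
  antipode_one : antipode 1 = 1
  antipode_mul : ∀ a b : A, antipode (a * b) = antipode b * antipode a
  /-- `(ε ⊗ id) ∘ Δ = id` -/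
  counit_comul : ∀ a : A,
    Algebra.TensorProduct.lid k A (Algebra.TensorProduct.map counit (AlgHom.id k A) (comul a)) = a
  /-- `(id ⊗ ε) ∘ Δ = id` -/
  comul_counit : ∀ a : A,
    Algebra.TensorProduct.rid k k A (Algebra.TensorProduct.map (AlgHom.id k A) counit (comul a)) = a
  /-- `(Δ ⊗ id)(Δ(a)) Φ = Φ (id ⊗ Δ)(Δ(a))` -/
  quasi_coassoc : ∀ a : A,
    comulLeft comul A (comul a) * (coassociator : A ⊗[k] (A ⊗[k] A)) =
      (coassociator : A ⊗[k] (A ⊗[k] A)) * idTensor A comul (comul a)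
  /-- `(id ⊗ ε ⊗ id)(Φ) = 1 ⊗ 1` -/
  counit_coassociator :
    idTensor A ((Algebra.TensorProduct.lid k A).toAlgHom.comp
      (Algebra.TensorProduct.map counit (AlgHom.id k A)))
        (coassociator : A ⊗[k] (A ⊗[k] A)) = 1
  /-- `(Δ ⊗ id ⊗ id)(Φ) (id ⊗ id ⊗ Δ)(Φ) = (Φ ⊗ 1) (id ⊗ Δ ⊗ id)(Φ) (1 ⊗ Φ)` -/
  cocycle :
    comulLeft comul (A ⊗[k] A) (coassociator : A ⊗[k] (A ⊗[k] A)) *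
        idTensor A (idTensor A comul) (coassociator : A ⊗[k] (A ⊗[k] A)) =
      idTensor A (idTensor A (Algebra.TensorProduct.includeLeft : A →ₐ[k] A ⊗[k] A))
          (coassociator : A ⊗[k] (A ⊗[k] A)) *
        idTensor A (comulLeft comul A) (coassociator : A ⊗[k] (A ⊗[k] A)) *
        (1 ⊗ₜ[k] (coassociator : A ⊗[k] (A ⊗[k] A)))
  /-- `∑ S(a') α a'' = ε(a) α` -/
  antipode_eval : ∀ a : A, evalMap antipode evalElt (comul a) = counit a • evalElt
  /-- `∑ a' β S(a'') = ε(a) β` -/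
  antipode_coeval : ∀ a : A, coevalMap antipode coevalElt (comul a) = counit a • coevalElt
  /-- `∑ S(Φ₁) α Φ₂ β S(Φ₃) = 1` -/
  zigzag :
    LinearMap.mul' k A (TensorProduct.map (LinearMap.mulRight k evalElt ∘ₗ antipode)
      (coevalMap antipode coevalElt) (coassociator : A ⊗[k] (A ⊗[k] A))) = 1
  /-- `∑ Ψ₁ β S(Ψ₂) α Ψ₃ = 1` for `Ψ = Φ⁻¹` -/
  zigzag_inv :
    LinearMap.mul' k A (TensorProduct.map (LinearMap.mulRight k coevalElt)
      (evalMap antipode evalElt) ((coassociator⁻¹ : (A ⊗[k] (A ⊗[k] A))ˣ) : A ⊗[k] (A ⊗[k] A))) = 1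

section Legs

variable (k : Type u) (A : Type v) [Field k] [Ring A] [Algebra k A]

/-- `a ⊗ b ↦ b ⊗ a`, so that `R₂₁ = swapTensor R`. -/
noncomputable def swapTensor : A ⊗[k] A →ₐ[k] A ⊗[k] A :=
  (Algebra.TensorProduct.comm k A A).toAlgHom

/-- `R ↦ R₁₂ = R₁ ⊗ R₂ ⊗ 1`. -/
noncomputable def leg12 : A ⊗[k] A →ₐ[k] A ⊗[k] (A ⊗[k] A) :=
  idTensor A Algebra.TensorProduct.includeLeft

/-- `R ↦ R₁₃ = R₁ ⊗ 1 ⊗ R₂`. -/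
noncomputable def leg13 : A ⊗[k] A →ₐ[k] A ⊗[k] (A ⊗[k] A) :=
  idTensor A Algebra.TensorProduct.includeRight

/-- `R ↦ R₂₃ = 1 ⊗ R₁ ⊗ R₂`. -/
noncomputable def leg23 : A ⊗[k] A →ₐ[k] A ⊗[k] (A ⊗[k] A) :=
  Algebra.TensorProduct.includeRight

/-- `X ↦ X₁₃₂ = X₁ ⊗ X₃ ⊗ X₂`. -/
noncomputable def perm132 : A ⊗[k] (A ⊗[k] A) →ₐ[k] A ⊗[k] (A ⊗[k] A) :=
  idTensor A (swapTensor k A)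

/-- `X ↦ X₂₁₃ = X₂ ⊗ X₁ ⊗ X₃`. -/
noncomputable def perm213 : A ⊗[k] (A ⊗[k] A) →ₐ[k] A ⊗[k] (A ⊗[k] A) :=
  (Algebra.TensorProduct.leftComm k A A A).toAlgHom

/-- `X ↦ X₂₃₁ = X₂ ⊗ X₃ ⊗ X₁`. -/
noncomputable def perm231 : A ⊗[k] (A ⊗[k] A) →ₐ[k] A ⊗[k] (A ⊗[k] A) :=
  (perm132 k A).comp (perm213 k A)

/-- `X ↦ X₃₁₂ = X₃ ⊗ X₁ ⊗ X₂`. -/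
noncomputable def perm312 : A ⊗[k] (A ⊗[k] A) →ₐ[k] A ⊗[k] (A ⊗[k] A) :=
  (perm213 k A).comp (perm132 k A)

variable {k A}

lemma swapTensor_tmul (a b : A) : swapTensor k A (a ⊗ₜ b) = b ⊗ₜ a := rfl
lemma leg12_tmul (a b : A) : leg12 k A (a ⊗ₜ b) = a ⊗ₜ (b ⊗ₜ 1) := rfl
lemma leg13_tmul (a b : A) : leg13 k A (a ⊗ₜ b) = a ⊗ₜ (1 ⊗ₜ b) := rfl
lemma leg23_tmul (a b : A) : leg23 k A (a ⊗ₜ b) = 1 ⊗ₜ (a ⊗ₜ b) := rfl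
lemma perm132_tmul (a b c : A) : perm132 k A (a ⊗ₜ (b ⊗ₜ c)) = a ⊗ₜ (c ⊗ₜ b) := rfl
lemma perm213_tmul (a b c : A) : perm213 k A (a ⊗ₜ (b ⊗ₜ c)) = b ⊗ₜ (a ⊗ₜ c) := rfl
lemma perm231_tmul (a b c : A) : perm231 k A (a ⊗ₜ (b ⊗ₜ c)) = b ⊗ₜ (c ⊗ₜ a) := rfl
lemma perm312_tmul (a b c : A) : perm312 k A (a ⊗ₜ (b ⊗ₜ c)) = c ⊗ₜ (a ⊗ₜ b) := rfl

lemma perm132_perm132 (x : A ⊗[k] (A ⊗[k] A)) : perm132 k A (perm132 k A x) = x := by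
  induction x with
  | zero => simp
  | add x y hx hy => simp only [map_add, hx, hy]
  | tmul a y =>
    induction y with
    | zero => simp
    | add x y hx hy => simp only [map_add, hx, hy, TensorProduct.tmul_add]
    | tmul b c => rfl

lemma perm213_perm213 (x : A ⊗[k] (A ⊗[k] A)) : perm213 k A (perm213 k A x) = x := by
  induction x with
  | zero => simp
  | add x y hx hy => simp only [map_add, hx, hy]
  | tmul a y =>
    induction y with
    | zero => simp
    | add x y hx hy => simp only [map_add, hx, hy, TensorProduct.tmul_add]
    | tmul b c => rfl

lemma perm213_leg13 (x : A ⊗[k] A) : perm213 k A (leg13 k A x) = leg23 k A x := by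
  induction x with
  | zero => simp
  | add x y hx hy => simp only [map_add, hx, hy]
  | tmul a y => rfl

lemma perm132_leg13 (x : A ⊗[k] A) : perm132 k A (leg13 k A x) = leg12 k A x := by
  induction x with
  | zero => simp
  | add x y hx hy => simp only [map_add, hx, hy]
  | tmul a y => rfl

lemma assoc_tmul_one (x : A ⊗[k] A) :
    Algebra.TensorProduct.assoc k k k A A A (x ⊗ₜ 1) = leg12 k A x := by
  induction x with
  | zero => simp
  | add x y hx hy => simp only [map_add, hx, hy, TensorProduct.add_tmul]
  | tmul a y => rfl

end Legs

open QuasiHopfAlgebra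

/-- The coassociator `Φ` as an element. -/
noncomputable def Phi (k : Type u) (A : Type v) [Field k] [Ring A] [Algebra k A]
    [QuasiHopfAlgebra k A] : A ⊗[k] (A ⊗[k] A) :=
  ((coassociator : (A ⊗[k] (A ⊗[k] A))ˣ) : A ⊗[k] (A ⊗[k] A))

/-- The inverse coassociator `Φ⁻¹` as an element. -/
noncomputable def PhiInv (k : Type u) (A : Type v) [Field k] [Ring A] [Algebra k A]
    [QuasiHopfAlgebra k A] : A ⊗[k] (A ⊗[k] A) :=
  ((coassociator⁻¹ : (A ⊗[k] (A ⊗[k] A))ˣ) : A ⊗[k] (A ⊗[k] A))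

/-- A quasi-triangular quasi-Hopf algebra: a quasi-Hopf algebra with a universal R-matrix. -/
class QuasiTriangularQuasiHopfAlgebra (k : Type u) (A : Type v) [Field k] [Ring A] [Algebra k A]
    extends QuasiHopfAlgebra k A where
  /-- the universal R-matrix -/
  rMatrix : (A ⊗[k] A)ˣ
  /-- `R Δ(a) = Δᵒᵖ(a) R` -/
  rMatrix_comul : ∀ a : A,
    (rMatrix : A ⊗[k] A) * comul a = swapTensor k A (comul a) * (rMatrix : A ⊗[k] A)
  /-- `(Δ ⊗ id)(R) = (Φ⁻¹)₂₃₁ R₁₃ Φ₁₃₂ R₂₃ Φ⁻¹` -/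
  hexagon_left :
    comulLeft comul A (rMatrix : A ⊗[k] A) =
      perm231 k A (PhiInv k A) * leg13 k A rMatrix * perm132 k A (Phi k A) *
        leg23 k A rMatrix * PhiInv k A
  /-- `(id ⊗ Δ)(R) = Φ₃₁₂ R₁₃ (Φ⁻¹)₂₁₃ R₁₂ Φ` -/
  hexagon_right :
    idTensor A comul (rMatrix : A ⊗[k] A) =
      perm312 k A (Phi k A) * leg13 k A rMatrix * perm213 k A (PhiInv k A) *
        leg12 k A rMatrix * Phi k A

/-- The universal R-matrix `R` as an element. -/
noncomputable def RMat (k : Type u) (A : Type v) [Field k] [Ring A] [Algebra k A]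
    [QuasiTriangularQuasiHopfAlgebra k A] : A ⊗[k] A :=
  ((QuasiTriangularQuasiHopfAlgebra.rMatrix : (A ⊗[k] A)ˣ) : A ⊗[k] A)

section BulacuTorrecillas

variable (k : Type u) (A : Type v) [Field k] [Ring A] [Algebra k A]

/-- `p = ∑ Φ₁ ⊗ Φ₂ β S(Φ₃)`. -/
noncomputable def pElt [QuasiHopfAlgebra k A] : A ⊗[k] A :=
  TensorProduct.map LinearMap.id (coevalMap (antipode (k := k)) (coevalElt k)) (Phi k A)

/-- `q̃ = ∑ S(Φ₁) α Φ₂ ⊗ Φ₃`. -/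
noncomputable def qTildeElt [QuasiHopfAlgebra k A] : A ⊗[k] A :=
  TensorProduct.map (evalMap (antipode (k := k)) (evalElt k)) LinearMap.id
    ((TensorProduct.assoc k A A A).symm (Phi k A))

variable {k A} in
/-- For `N ∈ A ⊗ A`, the linear map `y₁ ⊗ y₂ ⊗ y₃ ↦ (y₁ ⊗ y₂) N (1 ⊗ S(y₃))`. -/
noncomputable def closeUp (S : A →ₗ[k] A) (N : A ⊗[k] A) :
    A ⊗[k] (A ⊗[k] A) →ₗ[k] A ⊗[k] A :=
  (LinearMap.mul' k (A ⊗[k] A) ∘ₗ TensorProduct.map (LinearMap.mulRight k N)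
    ((Algebra.TensorProduct.includeRight : A →ₐ[k] A ⊗[k] A).toLinearMap ∘ₗ S)) ∘ₗ
      (TensorProduct.assoc k A A A).symm.toLinearMap

variable {k A} in
lemma closeUp_tmul (S : A →ₗ[k] A) (n₁ n₂ y₁ y₂ y₃ : A) :
    closeUp S (n₁ ⊗ₜ n₂) (y₁ ⊗ₜ (y₂ ⊗ₜ y₃)) = (y₁ * n₁) ⊗ₜ[k] (y₂ * n₂ * S y₃) := by
  simp [closeUp]

/-- The element
`∑ q̃₁ (Φ⁻¹)₁ R₂ R̃₁ p₁ ⊗ q̃₂' (Φ⁻¹)₂ R₁ R̃₂ p₂ S(q̃₂'' (Φ⁻¹)₃)` of `A ⊗ A`,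
where `R̃` is a copy of `R`. -/
noncomputable def btElement [QuasiTriangularQuasiHopfAlgebra k A] : A ⊗[k] A :=
  closeUp (antipode (k := k)) (swapTensor k A (RMat k A) * RMat k A * pElt k A)
    (idTensor A (comul (k := k)) (qTildeElt k A) * PhiInv k A)

/-- The Bulacu-Torrecillas map `A* → A`, `φ ↦ (φ ⊗ id)(M)` with `M = btElement k A`. -/
noncomputable def btMap [QuasiTriangularQuasiHopfAlgebra k A] : Module.Dual k A →ₗ[k] A where
  toFun φ := TensorProduct.lid k A (LinearMap.rTensor A φ (btElement k A))
  map_add' φ ψ := by simp [LinearMap.rTensor_add]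
  map_smul' c φ := by simp [LinearMap.rTensor_smul]

end BulacuTorrecillas


section ActionOnTensors

variable {k : Type u} [Field k] {A B C : Type*} [Ring A] [Algebra k A] [Ring B] [Algebra k B]
  [Ring C] [Algebra k C] {U V W U' V' : Type*} [AddCommGroup U] [Module k U] [AddCommGroup V]
  [Module k V] [AddCommGroup W] [Module k W] [AddCommGroup U'] [Module k U'] [AddCommGroup V']
  [Module k V']

/-- The action of `A ⊗ B` on `U ⊗ V`: `(a ⊗ b)(u ⊗ v) = (a u) ⊗ (b v)`. -/
noncomputable def tensorAct (ρ : A →ₐ[k] Module.End k U) (σ : B →ₐ[k] Module.End k V) :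
    A ⊗[k] B →ₐ[k] Module.End k (U ⊗[k] V) :=
  (Module.endTensorEndAlgHom (R := k) (S := k) (A := k)).comp (Algebra.TensorProduct.map ρ σ)

@[simp] lemma tensorAct_tmul (ρ : A →ₐ[k] Module.End k U) (σ : B →ₐ[k] Module.End k V)
    (a : A) (b : B) : tensorAct ρ σ (a ⊗ₜ b) = TensorProduct.map (ρ a) (σ b) := rfl

lemma tensorAct_comp_right (ρ : A →ₐ[k] Module.End k U) (σ : B →ₐ[k] Module.End k V)
    (g : C →ₐ[k] B) (x : A ⊗[k] C) :
    tensorAct ρ (σ.comp g) x = tensorAct ρ σ (idTensor A g x) := by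
  induction x with
  | zero => simp
  | add x y hx hy => simp [hx, hy]
  | tmul a b => simp [idTensor]

lemma tensorAct_comp_left (ρ : A →ₐ[k] Module.End k U) (σ : B →ₐ[k] Module.End k V)
    (g : C →ₐ[k] A) (x : C ⊗[k] B) :
    tensorAct (ρ.comp g) σ x =
      tensorAct ρ σ (Algebra.TensorProduct.map g (AlgHom.id k B) x) := by
  induction x with
  | zero => simp
  | add x y hx hy => simp [hx, hy]
  | tmul a b => simp

lemma tensorAct_assoc (ρ : A →ₐ[k] Module.End k U) (σ : B →ₐ[k] Module.End k V)
    (τ : C →ₐ[k] Module.End k W) (x : (A ⊗[k] B) ⊗[k] C) (v : (U ⊗[k] V) ⊗[k] W) :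
    TensorProduct.assoc k U V W (tensorAct (tensorAct ρ σ) τ x v) =
      tensorAct ρ (tensorAct σ τ) (Algebra.TensorProduct.assoc k k k A B C x)
        (TensorProduct.assoc k U V W v) := by
  induction x with
  | zero => simp
  | add x y hx hy => simp [hx, hy]
  | tmul x c =>
    induction x with
    | zero => simp
    | add x y hx hy => simp only [hx, hy, TensorProduct.add_tmul, map_add, LinearMap.add_apply]
    | tmul a b =>
      induction v with
      | zero => simp
      | add x y hx hy => simp only [map_add, hx, hy]
      | tmul v w =>
        induction v with
        | zero => simp
        | add x y hx hy => simp only [map_add, hx, hy, TensorProduct.add_tmul]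
        | tmul u v => simp

lemma tensorAct_comm (ρ : A →ₐ[k] Module.End k U) (σ : B →ₐ[k] Module.End k V)
    (x : A ⊗[k] B) (v : U ⊗[k] V) :
    TensorProduct.comm k U V (tensorAct ρ σ x v) =
      tensorAct σ ρ (Algebra.TensorProduct.comm k A B x) (TensorProduct.comm k U V v) := by
  induction x with
  | zero => simp
  | add x y hx hy => simp [hx, hy]
  | tmul a b =>
    induction v with
    | zero => simp
    | add x y hx hy => simp only [map_add, hx, hy]
    | tmul v w => simp

lemma tensorAct_natural (ρ : A →ₐ[k] Module.End k U) (σ : B →ₐ[k] Module.End k V)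
    (ρ' : A →ₐ[k] Module.End k U') (σ' : B →ₐ[k] Module.End k V') (f : U →ₗ[k] U')
    (g : V →ₗ[k] V') (hf : ∀ a u, f (ρ a u) = ρ' a (f u)) (hg : ∀ b v, g (σ b v) = σ' b (g v))
    (x : A ⊗[k] B) (v : U ⊗[k] V) :
    TensorProduct.map f g (tensorAct ρ σ x v) = tensorAct ρ' σ' x (TensorProduct.map f g v) := by
  induction x with
  | zero => simp
  | add x y hx hy => simp [hx, hy]
  | tmul a b =>
    induction v with
    | zero => simp
    | add x y hx hy => simp only [map_add, hx, hy]
    | tmul v w => simp [hf, hg]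

lemma tensorAct_leftComm (ρ : A →ₐ[k] Module.End k U) (σ : A →ₐ[k] Module.End k V)
    (τ : A →ₐ[k] Module.End k W) (x : A ⊗[k] (A ⊗[k] A)) (v : U ⊗[k] (V ⊗[k] W)) :
    TensorProduct.leftComm k U V W (tensorAct ρ (tensorAct σ τ) x v) =
      tensorAct σ (tensorAct ρ τ) (perm213 k A x) (TensorProduct.leftComm k U V W v) := by
  induction x with
  | zero => simp
  | add x y hx hy => simp [hx, hy]
  | tmul a y =>
    induction y with
    | zero => simp
    | add x y hx hy => simp only [hx, hy, TensorProduct.tmul_add, map_add, LinearMap.add_apply]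
    | tmul b c =>
      induction v with
      | zero => simp
      | add x y hx hy => simp only [map_add, hx, hy]
      | tmul u v =>
        induction v with
        | zero => simp
        | add x y hx hy => simp only [map_add, hx, hy, TensorProduct.tmul_add]
        | tmul v w => simp [perm213_tmul]

lemma tensorAct_rightComm (ρ : A →ₐ[k] Module.End k U) (σ : A →ₐ[k] Module.End k V)
    (τ : A →ₐ[k] Module.End k W) (x : A ⊗[k] (A ⊗[k] A)) (v : U ⊗[k] (V ⊗[k] W)) :
    TensorProduct.map LinearMap.id (TensorProduct.comm k V W).toLinearMap
        (tensorAct ρ (tensorAct σ τ) x v) =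
      tensorAct ρ (tensorAct τ σ) (perm132 k A x)
        (TensorProduct.map LinearMap.id (TensorProduct.comm k V W).toLinearMap v) := by
  rw [tensorAct_natural ρ (tensorAct σ τ) ρ ((tensorAct τ σ).comp (swapTensor k A)) LinearMap.id
    (TensorProduct.comm k V W).toLinearMap (fun _ _ => rfl) (tensorAct_comm σ τ),
    tensorAct_comp_right]
  rfl

lemma tensorAct_one_tmul (ρ : A →ₐ[k] Module.End k U) (σ : B →ₐ[k] Module.End k V) (b : B) :
    tensorAct ρ σ (1 ⊗ₜ b) = TensorProduct.map LinearMap.id (σ b) := by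
  rw [tensorAct_tmul, map_one]; rfl

lemma tensorAct_tmul_one (ρ : A →ₐ[k] Module.End k U) (σ : B →ₐ[k] Module.End k V) (a : A) :
    tensorAct ρ σ (a ⊗ₜ 1) = TensorProduct.map (ρ a) LinearMap.id := by
  rw [tensorAct_tmul, map_one]; rfl

/-- The linear automorphism by which a unit acts. -/
def unitEquiv (ρ : B →ₐ[k] Module.End k V) (b : Bˣ) : V ≃ₗ[k] V :=
  LinearEquiv.ofLinearMap (ρ b) (ρ (b⁻¹ : Bˣ))
    (by change ρ b * ρ (b⁻¹ : Bˣ) = 1; rw [← map_mul]; simp)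
    (by change ρ (b⁻¹ : Bˣ) * ρ b = 1; rw [← map_mul]; simp)

end ActionOnTensors

section LinearConstraints

variable {k : Type u} {A : Type v} [Field k] [Ring A] [Algebra k A]
  {U V W T U' V' W' : Type*} [AddCommGroup U] [Module k U] [AddCommGroup V] [Module k V]
  [AddCommGroup W] [Module k W] [AddCommGroup T] [Module k T]
  [AddCommGroup U'] [Module k U'] [AddCommGroup V'] [Module k V'] [AddCommGroup W'] [Module k W']

section QuasiHopf

variable [QuasiHopfAlgebra k A] (ρ : A →ₐ[k] Module.End k U) (σ : A →ₐ[k] Module.End k V)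
  (τ : A →ₐ[k] Module.End k W) (ζ : A →ₐ[k] Module.End k T)

lemma phiInv_mul_phi : PhiInv k A * Phi k A = 1 := by simp [Phi, PhiInv]
lemma phi_mul_phiInv : Phi k A * PhiInv k A = 1 := by simp [Phi, PhiInv]

lemma phiInv_comul (a : A) : PhiInv k A * comulLeft comul A (comul a) =
    idTensor A comul (comul a) * PhiInv k A := by
  have h := quasi_coassoc (k := k) a
  change _ * Phi k A = Phi k A * _ at h
  calc _ = PhiInv k A * (comulLeft comul A (comul a) * Phi k A) * PhiInv k A := by
        rw [mul_assoc, mul_assoc, phi_mul_phiInv, mul_one]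
    _ = _ := by rw [h, ← mul_assoc, phiInv_mul_phi, one_mul]

lemma inverse_cocycle :
    idTensor A (idTensor A comul) (PhiInv k A) * comulLeft comul (A ⊗[k] A) (PhiInv k A) =
      (1 ⊗ₜ[k] PhiInv k A) * idTensor A (comulLeft comul A) (PhiInv k A) *
        idTensor A (idTensor A (Algebra.TensorProduct.includeLeft : A →ₐ[k] A ⊗[k] A))
          (PhiInv k A) := by
  have h := cocycle (k := k) (A := A)
  let c : (A ⊗[k] (A ⊗[k] A))ˣ := coassociator
  let f₁ : A ⊗[k] (A ⊗[k] A) →* A ⊗[k] (A ⊗[k] (A ⊗[k] A)) :=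
    (comulLeft (k := k) (A := A) comul (A ⊗[k] A)).toRingHom.toMonoidHom
  let f₂ : A ⊗[k] (A ⊗[k] A) →* A ⊗[k] (A ⊗[k] (A ⊗[k] A)) :=
    (idTensor (k := k) A (idTensor A (comul (k := k) (A := A)))).toRingHom.toMonoidHom
  let f₃ : A ⊗[k] (A ⊗[k] A) →* A ⊗[k] (A ⊗[k] (A ⊗[k] A)) :=
    (idTensor A (idTensor A
      (Algebra.TensorProduct.includeLeft : A →ₐ[k] A ⊗[k] A))).toRingHom.toMonoidHom
  let f₄ : A ⊗[k] (A ⊗[k] A) →* A ⊗[k] (A ⊗[k] (A ⊗[k] A)) :=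
    (idTensor (k := k) A (comulLeft (k := k) (A := A) comul A)).toRingHom.toMonoidHom
  let f₅ : A ⊗[k] (A ⊗[k] A) →* A ⊗[k] (A ⊗[k] (A ⊗[k] A)) :=
    (Algebra.TensorProduct.includeRight :
      A ⊗[k] (A ⊗[k] A) →ₐ[k] A ⊗[k] (A ⊗[k] (A ⊗[k] A))).toRingHom.toMonoidHom
  have h' : Units.map f₁ c * Units.map f₂ c = Units.map f₃ c * Units.map f₄ c * Units.map f₅ c :=
    Units.ext h
  have h2 := congrArg (fun x => ((x⁻¹ : (A ⊗[k] (A ⊗[k] (A ⊗[k] A)))ˣ) :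
    A ⊗[k] (A ⊗[k] (A ⊗[k] A)))) h'
  simp only [mul_inv_rev, ← map_inv] at h2
  rw [← mul_assoc] at h2
  exact h2

lemma counit_phiInv :
    idTensor A ((Algebra.TensorProduct.lid k A).toAlgHom.comp
      (Algebra.TensorProduct.map (counit (k := k) (A := A)) (AlgHom.id k A))) (PhiInv k A) = 1 := by
  set f := idTensor A ((Algebra.TensorProduct.lid k A).toAlgHom.comp
      (Algebra.TensorProduct.map (counit (k := k) (A := A)) (AlgHom.id k A)))
  have h : f (Phi k A) = 1 := counit_coassociator (k := k) (A := A)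
  calc f (PhiInv k A) = f (PhiInv k A) * f (Phi k A) := by rw [h, mul_one]
    _ = 1 := by rw [← map_mul, phiInv_mul_phi, map_one]

/-- The action of `A` on a tensor product, through the coproduct. -/
noncomputable def tensorRep : A →ₐ[k] Module.End k (U ⊗[k] V) :=
  (tensorAct ρ σ).comp comul

variable (k A) in
/-- The trivial representation of `A` on `k`, through the counit. -/
noncomputable def trivRep : A →ₐ[k] Module.End k k :=
  (Algebra.ofId k (Module.End k k)).comp counit

lemma trivRep_apply (a : A) (c : k) : trivRep k A a c = counit a * c := rfl

/-- `(u ⊗ v) ⊗ w ↦ Φ⁻¹ (u ⊗ (v ⊗ w))`. -/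
noncomputable def assocEquiv : (U ⊗[k] V) ⊗[k] W ≃ₗ[k] U ⊗[k] (V ⊗[k] W) :=
  (TensorProduct.assoc k U V W).trans (unitEquiv (tensorAct ρ (tensorAct σ τ)) coassociator⁻¹)

lemma assocEquiv_apply (v : (U ⊗[k] V) ⊗[k] W) : assocEquiv ρ σ τ v =
    tensorAct ρ (tensorAct σ τ) (PhiInv k A) (TensorProduct.assoc k U V W v) := rfl

lemma assocEquiv_symm_apply (v : U ⊗[k] (V ⊗[k] W)) : (assocEquiv ρ σ τ).symm v =
    (TensorProduct.assoc k U V W).symm (tensorAct ρ (tensorAct σ τ) (Phi k A) v) := rfl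

lemma assocEquiv_comm (a : A) (v : (U ⊗[k] V) ⊗[k] W) :
    assocEquiv ρ σ τ (tensorRep (tensorRep ρ σ) τ a v) =
      tensorRep ρ (tensorRep σ τ) a (assocEquiv ρ σ τ v) := by
  simp only [assocEquiv_apply, tensorRep, AlgHom.comp_apply]
  rw [tensorAct_comp_left, tensorAct_assoc, tensorAct_comp_right, ← Module.End.mul_apply,
    ← Module.End.mul_apply, ← map_mul, ← map_mul, ← phiInv_comul]
  rfl

lemma assocEquiv_natural {ρ' : A →ₐ[k] Module.End k U'} {σ' : A →ₐ[k] Module.End k V'}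
    {τ' : A →ₐ[k] Module.End k W'} (f : U →ₗ[k] U') (g : V →ₗ[k] V') (h : W →ₗ[k] W')
    (hf : ∀ a u, f (ρ a u) = ρ' a (f u)) (hg : ∀ b v, g (σ b v) = σ' b (g v))
    (hh : ∀ b v, h (τ b v) = τ' b (h v)) (v : (U ⊗[k] V) ⊗[k] W) :
    assocEquiv ρ' σ' τ' (TensorProduct.map (TensorProduct.map f g) h v) =
      TensorProduct.map f (TensorProduct.map g h) (assocEquiv ρ σ τ v) := by
  simp only [assocEquiv_apply]
  rw [tensorAct_natural ρ (tensorAct σ τ) ρ' (tensorAct σ' τ') f (TensorProduct.map g h) hf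
    (tensorAct_natural σ τ σ' τ' g h hg hh)]
  congr 1
  exact (TensorProduct.map_map_assoc f g h v).symm

lemma lid_comm (a : A) (v : k ⊗[k] U) :
    TensorProduct.lid k U (tensorRep (trivRep k A) ρ a v) = ρ a (TensorProduct.lid k U v) := by
  have key : ∀ y : A ⊗[k] A, TensorProduct.lid k U (tensorAct (trivRep k A) ρ y v) =
      ρ (Algebra.TensorProduct.lid k A (Algebra.TensorProduct.map counit (AlgHom.id k A) y))
        (TensorProduct.lid k U v) := by
    intro y
    induction y with
    | zero => simp
    | add x y hx hy => simp [hx, hy]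
    | tmul a b =>
      induction v with
      | zero => simp
      | add x y hx hy => simp only [map_add, hx, hy]
      | tmul c v => simp [trivRep_apply, smul_smul, mul_comm]
  have := key (comul a)
  rwa [counit_comul] at this

lemma rid_comm (a : A) (v : U ⊗[k] k) :
    TensorProduct.rid k U (tensorRep ρ (trivRep k A) a v) = ρ a (TensorProduct.rid k U v) := by
  have key : ∀ y : A ⊗[k] A, TensorProduct.rid k U (tensorAct ρ (trivRep k A) y v) =
      ρ (Algebra.TensorProduct.rid k k A (Algebra.TensorProduct.map (AlgHom.id k A) counit y))
        (TensorProduct.rid k U v) := by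
    intro y
    induction y with
    | zero => simp
    | add x y hx hy => simp [hx, hy]
    | tmul a b =>
      induction v with
      | zero => simp
      | add x y hx hy => simp only [map_add, hx, hy]
      | tmul v c => simp [trivRep_apply, smul_smul, mul_comm]
  have := key (comul a)
  rwa [comul_counit] at this

lemma assocEquiv_pentagon (v : ((U ⊗[k] V) ⊗[k] W) ⊗[k] T) :
    TensorProduct.map LinearMap.id (assocEquiv σ τ ζ).toLinearMap
      (assocEquiv ρ (tensorRep σ τ) ζ
        (TensorProduct.map (assocEquiv ρ σ τ).toLinearMap LinearMap.id v)) =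
    assocEquiv ρ σ (tensorRep τ ζ) (assocEquiv (tensorRep ρ σ) τ ζ v) := by
  have e₁ : ∀ (ρ : A →ₐ[k] Module.End k U) (v : ((U ⊗[k] V) ⊗[k] W) ⊗[k] T),
      TensorProduct.map (assocEquiv ρ σ τ).toLinearMap LinearMap.id v =
      tensorAct (tensorAct ρ (tensorAct σ τ)) ζ (PhiInv k A ⊗ₜ 1)
        (TensorProduct.map (TensorProduct.assoc k U V W).toLinearMap LinearMap.id v) := by
    intro ρ v
    rw [tensorAct_tmul_one, ← LinearMap.comp_apply, ← TensorProduct.map_comp]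
    rfl
  have e₂ : ∀ v : U ⊗[k] ((V ⊗[k] W) ⊗[k] T),
      TensorProduct.map LinearMap.id (assocEquiv σ τ ζ).toLinearMap v =
      tensorAct ρ (tensorAct σ (tensorAct τ ζ)) (1 ⊗ₜ PhiInv k A)
        (TensorProduct.map LinearMap.id (TensorProduct.assoc k V W T).toLinearMap v) := by
    intro v
    rw [tensorAct_one_tmul, ← LinearMap.comp_apply, ← TensorProduct.map_comp]
    rfl
  have e₃ : ∀ (x : A ⊗[k] ((A ⊗[k] A) ⊗[k] A)) (v : U ⊗[k] ((V ⊗[k] W) ⊗[k] T)),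
      TensorProduct.map LinearMap.id (TensorProduct.assoc k V W T).toLinearMap
        (tensorAct ρ (tensorAct (tensorAct σ τ) ζ) x v) =
      tensorAct ρ (tensorAct σ (tensorAct τ ζ))
        (idTensor A (Algebra.TensorProduct.assoc k k k A A A).toAlgHom x)
        (TensorProduct.map LinearMap.id (TensorProduct.assoc k V W T).toLinearMap v) := by
    intro x v
    rw [tensorAct_natural ρ (tensorAct (tensorAct σ τ) ζ) ρ
      ((tensorAct σ (tensorAct τ ζ)).comp (Algebra.TensorProduct.assoc k k k A A A).toAlgHom)
      LinearMap.id (TensorProduct.assoc k V W T).toLinearMap (fun _ _ => rfl)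
      (tensorAct_assoc σ τ ζ), tensorAct_comp_right]
  have e₄ : ∀ x : A ⊗[k] (A ⊗[k] A), tensorAct ρ (tensorAct (tensorRep σ τ) ζ) x =
      tensorAct ρ (tensorAct (tensorAct σ τ) ζ)
        (idTensor A (Algebra.TensorProduct.map comul (AlgHom.id k A)) x) := by
    intro x
    rw [← tensorAct_comp_right]
    congr 2
    exact AlgHom.ext (tensorAct_comp_left (tensorAct σ τ) ζ comul)
  have e₅ : tensorAct σ (tensorRep τ ζ) =
      (tensorAct σ (tensorAct τ ζ)).comp (idTensor A comul) :=
    AlgHom.ext (tensorAct_comp_right σ (tensorAct τ ζ) comul)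
  have e₆ : ∀ x : A ⊗[k] (A ⊗[k] A),
      idTensor A (Algebra.TensorProduct.assoc k k k A A A).toAlgHom
        (Algebra.TensorProduct.assoc k k k A (A ⊗[k] A) A (x ⊗ₜ 1)) =
      idTensor A (idTensor A (Algebra.TensorProduct.includeLeft : A →ₐ[k] A ⊗[k] A)) x := by
    intro x
    induction x with
    | zero => simp
    | add x y hx hy => simp only [TensorProduct.add_tmul, map_add, hx, hy]
    | tmul a x =>
      induction x with
      | zero => simp
      | add x y hx hy => simp only [TensorProduct.add_tmul, TensorProduct.tmul_add, map_add, hx, hy]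
      | tmul b c => simp [idTensor]
  have e₇ : ∀ x : A ⊗[k] (A ⊗[k] A), idTensor A (Algebra.TensorProduct.assoc k k k A A A).toAlgHom
      (idTensor A (Algebra.TensorProduct.map comul (AlgHom.id k A)) x) =
      idTensor A (comulLeft (k := k) comul A) x := by
    intro x
    induction x with
    | zero => simp
    | add x y hx hy => simp only [map_add, hx, hy]
    | tmul a b => simp [idTensor, comulLeft]
  have e₈ : ∀ v : ((U ⊗[k] V) ⊗[k] W) ⊗[k] T,
      TensorProduct.map LinearMap.id (TensorProduct.assoc k V W T).toLinearMap
      (TensorProduct.assoc k U (V ⊗[k] W) T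
        (TensorProduct.map (TensorProduct.assoc k U V W).toLinearMap LinearMap.id v)) =
      TensorProduct.assoc k U V (W ⊗[k] T) (TensorProduct.assoc k (U ⊗[k] V) W T v) := by
    intro v
    have : TensorProduct.map LinearMap.id (TensorProduct.assoc k V W T).toLinearMap ∘ₗ
      (TensorProduct.assoc k U (V ⊗[k] W) T).toLinearMap ∘ₗ
        (TensorProduct.map (TensorProduct.assoc k U V W).toLinearMap LinearMap.id) =
      (TensorProduct.assoc k U V (W ⊗[k] T)).toLinearMap ∘ₗ
        (TensorProduct.assoc k (U ⊗[k] V) W T).toLinearMap := by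
      apply TensorProduct.ext_fourfold
      intros
      simp
    exact LinearMap.congr_fun this v
  rw [e₁, assocEquiv_apply, tensorAct_assoc, e₄, ← Module.End.mul_apply, ← map_mul, e₂, e₃,
    map_mul (idTensor A _), e₆, e₇, e₈, ← Module.End.mul_apply, ← map_mul, assocEquiv_apply, assocEquiv_apply,
    e₅, tensorAct_comp_right, tensorRep, tensorAct_comp_left, tensorAct_assoc,
    ← Module.End.mul_apply, ← map_mul, ← mul_assoc, ← inverse_cocycle]
  rfl

lemma assocEquiv_triangle (v : (U ⊗[k] k) ⊗[k] V) :
    TensorProduct.map LinearMap.id (TensorProduct.lid k V).toLinearMap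
      (assocEquiv ρ (trivRep k A) σ v) =
    TensorProduct.map (TensorProduct.rid k U).toLinearMap LinearMap.id v := by
  have hg : ∀ (y : A ⊗[k] A) (v : k ⊗[k] V),
      (TensorProduct.lid k V).toLinearMap (tensorAct (trivRep k A) σ y v) =
      σ.comp ((Algebra.TensorProduct.lid k A).toAlgHom.comp
        (Algebra.TensorProduct.map (counit (k := k)) (AlgHom.id k A))) y
        ((TensorProduct.lid k V).toLinearMap v) := by
    intro y v
    induction y with
    | zero => simp
    | add x y hx hy => simp only [map_add, LinearMap.add_apply, hx, hy]
    | tmul a b =>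
      induction v with
      | zero => simp
      | add x y hx hy => simp only [map_add, hx, hy]
      | tmul c v => simp [trivRep_apply, smul_smul, mul_comm]
  rw [assocEquiv_apply, tensorAct_natural ρ (tensorAct (trivRep k A) σ) ρ _ LinearMap.id
    (TensorProduct.lid k V).toLinearMap (fun _ _ => rfl) hg, tensorAct_comp_right, counit_phiInv,
    map_one, Module.End.one_apply]
  have : TensorProduct.map LinearMap.id (TensorProduct.lid k V).toLinearMap ∘ₗ
      (TensorProduct.assoc k U k V).toLinearMap =
      TensorProduct.map (TensorProduct.rid k U).toLinearMap LinearMap.id := by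
    apply TensorProduct.ext_threefold
    intros
    simp [TensorProduct.smul_tmul]
  exact LinearMap.congr_fun this v

/-- The dual representation: `(a f)(u) = f(S(a) u)`. -/
noncomputable def dualRep : A →ₐ[k] Module.End k (Module.Dual k U) :=
  AlgHom.ofLinearMap
    { toFun := fun a => (ρ (antipode (k := k) a)).dualMap
      map_add' := fun a b => by ext; simp
      map_smul' := fun c a => by ext; simp }
    (by ext; simp [antipode_one])
    (fun a b => by ext; simp [antipode_mul])

lemma dualRep_apply (a : A) (f : Module.Dual k U) (u : U) :
    dualRep ρ a f u = f (ρ (antipode (k := k) a) u) := rfl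

/-- `φ ⊗ u ↦ φ(α u)`. -/
noncomputable def evalLin : Module.Dual k U ⊗[k] U →ₗ[k] k :=
  contractLeft k U ∘ₗ TensorProduct.map LinearMap.id (ρ (evalElt k))

lemma evalLin_tmul (φ : Module.Dual k U) (u : U) :
    evalLin ρ (φ ⊗ₜ u) = φ (ρ (evalElt k) u) := by simp [evalLin]

lemma evalLin_comm (a : A) (v : Module.Dual k U ⊗[k] U) :
    evalLin ρ (tensorRep (dualRep ρ) ρ a v) = trivRep k A a (evalLin ρ v) := by
  have key : ∀ x : A ⊗[k] A, evalLin ρ (tensorAct (dualRep ρ) ρ x v) =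
      contractLeft k U (TensorProduct.map LinearMap.id
        (ρ (evalMap (antipode (k := k)) (evalElt k) x)) v) := by
    intro x
    induction x with
    | zero => simp
    | add x y hx hy => simp only [map_add, LinearMap.add_apply, hx, hy, TensorProduct.map_add_right]
    | tmul a b =>
      induction v with
      | zero => simp
      | add x y hx hy => simp only [map_add, hx, hy]
      | tmul c v => simp [evalLin_tmul, dualRep_apply]
  have := key (comul a)
  rw [antipode_eval] at this
  refine Eq.trans this ?_
  rw [trivRep_apply, map_smul, TensorProduct.map_smul_right]
  simp [evalLin]


end QuasiHopf
end LinearConstraints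

section Coev

variable {k : Type u} [Field k] {U : Type*} [AddCommGroup U] [Module k U] [FiniteDimensional k U]

lemma coevaluation_dualMap (f : U →ₗ[k] U) :
    TensorProduct.map LinearMap.id f.dualMap (coevaluation k U 1) =
      TensorProduct.map f LinearMap.id (coevaluation k U 1) := by
  rw [coevaluation_apply_one]
  set b := Module.Basis.ofVectorSpace k U
  simp only [map_sum, TensorProduct.map_tmul, LinearMap.id_apply]
  have h1 : ∀ i, f.dualMap (b.coord i) = ∑ j, b.coord i (f (b j)) • b.coord j := by
    intro i
    apply b.ext
    intro l
    classical
    simp [Finsupp.single_apply]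
  have h2 : ∀ j, f (b j) = ∑ i, b.coord i (f (b j)) • b i := by
    intro j
    exact (b.sum_repr (f (b j))).symm
  conv_lhs => enter [2, i]; rw [h1, TensorProduct.tmul_sum]
  conv_rhs => enter [2, j]; rw [h2, TensorProduct.sum_tmul]
  rw [Finset.sum_comm]
  refine Finset.sum_congr rfl fun j _ => Finset.sum_congr rfl fun i _ => ?_
  rw [TensorProduct.tmul_smul, TensorProduct.smul_tmul']

section QuasiHopf

variable {A : Type v} [Ring A] [Algebra k A] [QuasiHopfAlgebra k A] (ρ : A →ₐ[k] Module.End k U)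

/-- `1 ↦ ∑ (β uᵢ) ⊗ uᵢ*`. -/
noncomputable def coevalLin : k →ₗ[k] U ⊗[k] Module.Dual k U :=
  TensorProduct.map (ρ (coevalElt k)) LinearMap.id ∘ₗ coevaluation k U

lemma tensorAct_coevaluation (x : A ⊗[k] A) :
    tensorAct ρ (dualRep ρ) x (coevalLin ρ 1) =
      TensorProduct.map (ρ (coevalMap (antipode (k := k)) (coevalElt k) x)) LinearMap.id
        (coevaluation k U 1) := by
  induction x with
  | zero => simp
  | add x y hx hy => simp only [map_add, LinearMap.add_apply, hx, hy, TensorProduct.map_add_left]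
  | tmul a b =>
    have e : TensorProduct.map (ρ a) (dualRep ρ b) ∘ₗ
        TensorProduct.map (ρ (coevalElt k)) LinearMap.id =
        TensorProduct.map (ρ a * ρ (coevalElt k)) LinearMap.id ∘ₗ
          TensorProduct.map LinearMap.id (ρ (antipode (k := k) b)).dualMap := by
      rw [← TensorProduct.map_comp, ← TensorProduct.map_comp]
      rfl
    have := LinearMap.congr_fun e (coevaluation k U 1)
    rw [LinearMap.comp_apply] at this
    rw [tensorAct_tmul]
    refine this.trans ?_
    rw [LinearMap.comp_apply, coevaluation_dualMap, ← LinearMap.comp_apply,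
      ← TensorProduct.map_comp, coevalMap_tmul, map_mul, map_mul]
    rfl

lemma coevalLin_comm (a : A) (c : k) :
    coevalLin ρ (trivRep k A a c) = tensorRep ρ (dualRep ρ) a (coevalLin ρ c) := by
  have h : tensorRep ρ (dualRep ρ) a (coevalLin ρ 1) = counit (k := k) a • coevalLin ρ 1 := by
    rw [tensorRep, AlgHom.comp_apply, tensorAct_coevaluation, antipode_coeval, map_smul,
      TensorProduct.map_smul_left]
    rfl
  rw [trivRep_apply, ← smul_eq_mul, map_smul, ← mul_one c, ← smul_eq_mul, map_smul, map_smul, h]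
  simp only [smul_smul, mul_comm]

lemma evalLin_coevalLin (φ : Module.Dual k U) :
    TensorProduct.map (evalLin ρ) LinearMap.id
      ((assocEquiv (dualRep ρ) ρ (dualRep ρ)).symm (φ ⊗ₜ coevalLin ρ 1)) = 1 ⊗ₜ φ := by
  have key : ∀ x : A ⊗[k] (A ⊗[k] A), TensorProduct.map (evalLin ρ) LinearMap.id
      ((TensorProduct.assoc k _ _ _).symm
        (tensorAct (dualRep ρ) (tensorAct ρ (dualRep ρ)) x (φ ⊗ₜ coevalLin ρ 1))) =
      (contractLeft k U).rTensor _ ((TensorProduct.assoc k _ _ _).symm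
        (φ ⊗ₜ TensorProduct.map (ρ (LinearMap.mul' k A (TensorProduct.map
          (LinearMap.mulRight k (evalElt k) ∘ₗ antipode)
          (coevalMap antipode (coevalElt k)) x))) LinearMap.id (coevaluation k U 1))) := by
    intro x
    induction x with
    | zero => simp
    | add x y hx hy =>
      simp only [map_add, LinearMap.add_apply, hx, hy, TensorProduct.map_add_left,
        TensorProduct.tmul_add]
    | tmul a y =>
      rw [tensorAct_tmul, TensorProduct.map_tmul, tensorAct_coevaluation]
      have e : ∀ w : U ⊗[k] Module.Dual k U, ∀ f : U →ₗ[k] U,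
          TensorProduct.map (evalLin ρ) LinearMap.id ((TensorProduct.assoc k _ _ _).symm
            (dualRep ρ a φ ⊗ₜ TensorProduct.map f LinearMap.id w)) =
          (contractLeft k U).rTensor _ ((TensorProduct.assoc k _ _ _).symm
            (φ ⊗ₜ TensorProduct.map (ρ (antipode (k := k) a * evalElt k) * f) LinearMap.id w)) := by
        intro w f
        induction w with
        | zero => simp
        | add x y hx hy => simp only [map_add, hx, hy, TensorProduct.tmul_add]
        | tmul u ψ => simp [evalLin_tmul, dualRep_apply]
      rw [e, ← map_mul]
      simp
  rw [assocEquiv_symm_apply, key]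
  have hz := zigzag (k := k) (A := A)
  change LinearMap.mul' k A (TensorProduct.map _ _ (Phi k A)) = 1 at hz
  rw [hz, map_one, Module.End.one_eq_id, TensorProduct.map_id, LinearMap.id_apply]
  have := LinearMap.congr_fun (contractLeft_assoc_coevaluation k U) (φ ⊗ₜ 1)
  simpa using! this

lemma coevalLin_evalLin (u : U) :
    TensorProduct.map LinearMap.id (evalLin ρ)
      (assocEquiv ρ (dualRep ρ) ρ (coevalLin ρ 1 ⊗ₜ u)) = u ⊗ₜ 1 := by
  have key : ∀ x : A ⊗[k] (A ⊗[k] A), TensorProduct.map LinearMap.id (evalLin ρ)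
        (tensorAct ρ (tensorAct (dualRep ρ) ρ) x
          (TensorProduct.assoc k _ _ _ (coevalLin ρ 1 ⊗ₜ u))) =
      ρ (LinearMap.mul' k A (TensorProduct.map (LinearMap.mulRight k (coevalElt k))
          (evalMap antipode (evalElt k)) x)) u ⊗ₜ 1 := by
    intro x
    induction x with
    | zero => simp
    | add x y hx hy =>
      simp only [map_add, LinearMap.add_apply, hx, hy, TensorProduct.add_tmul]
    | tmul a y =>
      induction y with
      | zero => simp
      | add x y hx hy =>
        simp only [map_add, LinearMap.add_apply, hx, hy, TensorProduct.add_tmul,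
          TensorProduct.tmul_add]
      | tmul b c =>
        have e : ∀ w : U ⊗[k] Module.Dual k U,
            TensorProduct.map LinearMap.id (evalLin ρ)
              (tensorAct ρ (tensorAct (dualRep ρ) ρ) (a ⊗ₜ (b ⊗ₜ c))
                (TensorProduct.assoc k _ _ _ (w ⊗ₜ u))) =
            (contractLeft k U).lTensor _ (TensorProduct.assoc k _ _ _
              (tensorAct ρ (dualRep ρ) (a ⊗ₜ b) w ⊗ₜ ρ (evalElt k * c) u)) := by
          intro w
          induction w with
          | zero => simp
          | add x y hx hy => simp only [map_add, hx, hy, TensorProduct.add_tmul]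
          | tmul v ψ => simp [evalLin_tmul]
        have e' : ∀ (f : U →ₗ[k] U) (w : U ⊗[k] Module.Dual k U) (v : U),
            (contractLeft k U).lTensor _ (TensorProduct.assoc k _ _ _
              (TensorProduct.map f LinearMap.id w ⊗ₜ v)) =
            TensorProduct.map f LinearMap.id ((contractLeft k U).lTensor _
              (TensorProduct.assoc k _ _ _ (w ⊗ₜ v))) := by
          intro f w v
          induction w with
          | zero => simp
          | add x y hx hy => simp only [map_add, hx, hy, TensorProduct.add_tmul]
          | tmul v ψ => simp
        have h1 : ∀ v : U, (contractLeft k U).lTensor _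
            (TensorProduct.assoc k _ _ _ (coevaluation k U 1 ⊗ₜ v)) = v ⊗ₜ 1 := by
          intro v
          have := LinearMap.congr_fun (contractLeft_assoc_coevaluation' k U) (1 ⊗ₜ v)
          simpa using! this
        rw [e, tensorAct_coevaluation, e', h1]
        simp [mul_assoc]
  rw [assocEquiv_apply, key]
  have hz := zigzag_inv (k := k) (A := A)
  change LinearMap.mul' k A (TensorProduct.map _ _ (PhiInv k A)) = 1 at hz
  rw [hz, map_one]
  rfl

end QuasiHopf
end Coev

section Braiding

variable {k : Type u} {A : Type v} [Field k] [Ring A] [Algebra k A]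
  [QuasiTriangularQuasiHopfAlgebra k A] {U V W U' V' : Type*}
  [AddCommGroup U] [Module k U] [AddCommGroup V] [Module k V]
  [AddCommGroup W] [Module k W] [AddCommGroup U'] [Module k U'] [AddCommGroup V'] [Module k V']
  (ρ : A →ₐ[k] Module.End k U) (σ : A →ₐ[k] Module.End k V) (τ : A →ₐ[k] Module.End k W)

/-- `u ⊗ v ↦ τ(R (u ⊗ v))`, where `τ` is the flip. -/
noncomputable def braidEquiv : U ⊗[k] V ≃ₗ[k] V ⊗[k] U :=
  (unitEquiv (tensorAct ρ σ) QuasiTriangularQuasiHopfAlgebra.rMatrix).trans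
    (TensorProduct.comm k U V)

lemma braidEquiv_apply (v : U ⊗[k] V) :
    braidEquiv ρ σ v = TensorProduct.comm k U V (tensorAct ρ σ (RMat k A) v) := rfl

lemma braidEquiv_comm (a : A) (v : U ⊗[k] V) :
    braidEquiv ρ σ (tensorRep ρ σ a v) = tensorRep σ ρ a (braidEquiv ρ σ v) := by
  have h : RMat k A * comul a = swapTensor k A (comul a) * RMat k A :=
    QuasiTriangularQuasiHopfAlgebra.rMatrix_comul a
  have h' : ∀ x : A ⊗[k] A, Algebra.TensorProduct.comm k A A (swapTensor k A x) = x := by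
    intro x
    induction x with
    | zero => simp
    | add x y hx hy => simp only [map_add, hx, hy]
    | tmul a b => rfl
  simp only [braidEquiv_apply, tensorRep, AlgHom.comp_apply]
  rw [← Module.End.mul_apply, ← map_mul, h, map_mul, Module.End.mul_apply, tensorAct_comm, h']

lemma braidEquiv_natural {ρ' : A →ₐ[k] Module.End k U'} {σ' : A →ₐ[k] Module.End k V'}
    (f : U →ₗ[k] U') (g : V →ₗ[k] V')
    (hf : ∀ a u, f (ρ a u) = ρ' a (f u)) (hg : ∀ b v, g (σ b v) = σ' b (g v)) (v : U ⊗[k] V) :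
    braidEquiv ρ' σ' (TensorProduct.map f g v) = TensorProduct.map g f (braidEquiv ρ σ v) := by
  rw [braidEquiv_apply, braidEquiv_apply, ← tensorAct_natural ρ σ ρ' σ' f g hf hg,
    TensorProduct.map_comm]

lemma braid_left (v : (U ⊗[k] V) ⊗[k] W) :
    TensorProduct.assoc k V U W (TensorProduct.map (braidEquiv ρ σ).toLinearMap LinearMap.id v) =
      TensorProduct.leftComm k U V W (tensorAct ρ (tensorAct σ τ) (leg12 k A (RMat k A))
        (TensorProduct.assoc k U V W v)) := by
  have e : TensorProduct.map (braidEquiv ρ σ).toLinearMap LinearMap.id v =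
      TensorProduct.map (TensorProduct.comm k U V).toLinearMap LinearMap.id
        (tensorAct (tensorAct ρ σ) τ (RMat k A ⊗ₜ 1) v) := by
    rw [tensorAct_tmul_one, ← LinearMap.comp_apply, ← TensorProduct.map_comp]
    rfl
  have e' : ∀ v : (U ⊗[k] V) ⊗[k] W, TensorProduct.assoc k V U W
      (TensorProduct.map (TensorProduct.comm k U V).toLinearMap LinearMap.id v) =
      TensorProduct.leftComm k U V W (TensorProduct.assoc k U V W v) := by
    intro v
    have : (TensorProduct.assoc k V U W).toLinearMap ∘ₗ
        TensorProduct.map (TensorProduct.comm k U V).toLinearMap LinearMap.id =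
        (TensorProduct.leftComm k U V W).toLinearMap ∘ₗ
          (TensorProduct.assoc k U V W).toLinearMap := by
      apply TensorProduct.ext_threefold
      intros
      simp
    exact LinearMap.congr_fun this v
  rw [e, e', tensorAct_assoc, assoc_tmul_one]

lemma braid_right (v : U ⊗[k] (V ⊗[k] W)) :
    TensorProduct.map LinearMap.id (braidEquiv σ τ).toLinearMap v =
      TensorProduct.map LinearMap.id (TensorProduct.comm k V W).toLinearMap
        (tensorAct ρ (tensorAct σ τ) (leg23 k A (RMat k A)) v) := by
  have : leg23 k A (RMat k A) = 1 ⊗ₜ RMat k A := rfl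
  rw [this, tensorAct_one_tmul, ← LinearMap.comp_apply, ← TensorProduct.map_comp]
  rfl

lemma assoc_comm_eq (v : U ⊗[k] (V ⊗[k] W)) :
    TensorProduct.assoc k V W U (TensorProduct.comm k U (V ⊗[k] W) v) =
      TensorProduct.map LinearMap.id (TensorProduct.comm k U W).toLinearMap
        (TensorProduct.leftComm k U V W v) := by
  induction v with
  | zero => simp
  | add x y hx hy => simp only [map_add, hx, hy]
  | tmul u v =>
    induction v with
    | zero => simp
    | add x y hx hy => simp only [map_add, hx, hy, TensorProduct.tmul_add]
    | tmul v w => simp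

lemma comm_assoc_symm_eq (v : U ⊗[k] (V ⊗[k] W)) :
    TensorProduct.comm k (U ⊗[k] V) W ((TensorProduct.assoc k U V W).symm v) =
      TensorProduct.leftComm k U W V
        (TensorProduct.map LinearMap.id (TensorProduct.comm k V W).toLinearMap v) := by
  induction v with
  | zero => simp
  | add x y hx hy => simp only [map_add, hx, hy]
  | tmul u v =>
    induction v with
    | zero => simp
    | add x y hx hy => simp only [map_add, hx, hy, TensorProduct.tmul_add]
    | tmul v w => simp

lemma braidEquiv_hexagon_forward (v : (U ⊗[k] V) ⊗[k] W) :
    assocEquiv σ τ ρ (braidEquiv ρ (tensorRep σ τ) (assocEquiv ρ σ τ v)) =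
      TensorProduct.map LinearMap.id (braidEquiv ρ τ).toLinearMap
        (assocEquiv σ ρ τ
          (TensorProduct.map (braidEquiv ρ σ).toLinearMap LinearMap.id v)) := by
  have hex : idTensor A comul (RMat k A) =
      perm312 k A (Phi k A) * leg13 k A (RMat k A) * perm213 k A (PhiInv k A) *
        leg12 k A (RMat k A) * Phi k A :=
    QuasiTriangularQuasiHopfAlgebra.hexagon_right
  have hex' : idTensor A comul (RMat k A) * PhiInv k A =
      perm312 k A (Phi k A) * leg13 k A (RMat k A) * perm213 k A (PhiInv k A) *
        leg12 k A (RMat k A) := by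
    rw [hex, mul_assoc, phi_mul_phiInv, mul_one]
  rw [braid_right σ ρ τ, assocEquiv_apply σ ρ τ, braid_left ρ σ τ, tensorAct_leftComm,
    ← Module.End.mul_apply, ← map_mul, ← Module.End.mul_apply, ← map_mul, tensorAct_rightComm,
    assocEquiv_apply σ τ ρ, braidEquiv_apply, tensorRep, tensorAct_comp_right,
    assocEquiv_apply ρ σ τ, ← Module.End.mul_apply (tensorAct ρ (tensorAct σ τ) _), ← map_mul,
    hex', assoc_comm_eq, tensorAct_leftComm, tensorAct_rightComm, ← Module.End.mul_apply,
    ← map_mul]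
  congr 2
  simp only [map_mul, perm312, AlgHom.comp_apply, perm213_perm213, perm132_perm132, perm213_leg13]
  simp only [← mul_assoc, phiInv_mul_phi, one_mul]

lemma braidEquiv_hexagon_reverse (v : U ⊗[k] (V ⊗[k] W)) :
    (assocEquiv τ ρ σ).symm (braidEquiv (tensorRep ρ σ) τ ((assocEquiv ρ σ τ).symm v)) =
      TensorProduct.map (braidEquiv ρ τ).toLinearMap LinearMap.id
        ((assocEquiv ρ τ σ).symm
          (TensorProduct.map LinearMap.id (braidEquiv σ τ).toLinearMap v)) := by
  have hex : comulLeft comul A (RMat k A) =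
      perm231 k A (PhiInv k A) * leg13 k A (RMat k A) * perm132 k A (Phi k A) *
        leg23 k A (RMat k A) * PhiInv k A :=
    QuasiTriangularQuasiHopfAlgebra.hexagon_left
  have hex' : comulLeft comul A (RMat k A) * Phi k A =
      perm231 k A (PhiInv k A) * leg13 k A (RMat k A) * perm132 k A (Phi k A) *
        leg23 k A (RMat k A) := by
    rw [hex, mul_assoc, phiInv_mul_phi, mul_one]
  have e : ∀ (x : A ⊗[k] A) (v : U ⊗[k] (V ⊗[k] W)),
      tensorAct (tensorRep ρ σ) τ x ((TensorProduct.assoc k U V W).symm v) =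
      (TensorProduct.assoc k U V W).symm (tensorAct ρ (tensorAct σ τ)
        (comulLeft comul A x) v) := by
    intro x v
    rw [LinearEquiv.eq_symm_apply, tensorRep, tensorAct_comp_left, tensorAct_assoc,
      LinearEquiv.apply_symm_apply]
    rfl
  apply (TensorProduct.assoc k W U V).injective
  rw [braid_left ρ τ σ, assocEquiv_symm_apply ρ τ σ, LinearEquiv.apply_symm_apply,
    ← Module.End.mul_apply, ← map_mul, braid_right ρ σ τ, tensorAct_rightComm,
    ← Module.End.mul_apply, ← map_mul, tensorAct_leftComm, assocEquiv_symm_apply τ ρ σ,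
    LinearEquiv.apply_symm_apply, braidEquiv_apply, assocEquiv_symm_apply ρ σ τ, e,
    ← Module.End.mul_apply, ← map_mul, hex', comm_assoc_symm_eq, tensorAct_rightComm,
    tensorAct_leftComm, ← Module.End.mul_apply, ← map_mul]
  congr 2
  simp only [map_mul, perm231, AlgHom.comp_apply, perm213_perm213, perm132_perm132, perm132_leg13]
  simp only [← mul_assoc, phi_mul_phiInv, one_mul]

end Braiding


open CategoryTheory MonoidalCategory

/-- Finite-dimensional representations of the `k`-algebra `A`. -/
structure RepFin (k : Type u) (A : Type u) [Field k] [Ring A] [Algebra k A] : Type (u + 1) where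
  /-- the underlying vector space -/
  V : Type u
  [addCommGroup : AddCommGroup V]
  [module : Module k V]
  [finite : FiniteDimensional k V]
  /-- the action of `A` -/
  ρ : A →ₐ[k] Module.End k V

attribute [instance] RepFin.addCommGroup RepFin.module RepFin.finite

namespace RepFin

section Category

variable {k A : Type u} [Field k] [Ring A] [Algebra k A]

/-- Morphisms of representations: linear maps that commute with the action of `A`. -/
@[ext]
structure Hom (X Y : RepFin k A) where
  /-- the underlying linear map -/
  toLin : X.V →ₗ[k] Y.V
  comm : ∀ (a : A) (x : X.V), toLin (X.ρ a x) = Y.ρ a (toLin x)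

instance : Category (RepFin k A) where
  Hom := Hom
  id X := ⟨LinearMap.id, fun _ _ => rfl⟩
  comp f g := ⟨g.toLin ∘ₗ f.toLin, fun a x => by simp [f.comm, g.comm]⟩

lemma hom_ext {X Y : RepFin k A} {f g : X ⟶ Y} (h : ∀ x, f.toLin x = g.toLin x) : f = g :=
  Hom.ext (LinearMap.ext h)

/-- An isomorphism of representations from a linear equivalence that commutes with the action. -/
def isoMk {X Y : RepFin k A} (e : X.V ≃ₗ[k] Y.V)
    (h : ∀ (a : A) (x : X.V), e (X.ρ a x) = Y.ρ a (e x)) : X ≅ Y where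
  hom := ⟨e.toLinearMap, h⟩
  inv := ⟨e.symm.toLinearMap, fun a y => by
    apply e.injective
    simp [h]⟩
  hom_inv_id := hom_ext fun x => e.symm_apply_apply x
  inv_hom_id := hom_ext fun x => e.apply_symm_apply x

end Category

section Monoidal

variable {k A : Type u} [Field k] [Ring A] [Algebra k A] [QuasiHopfAlgebra k A]

/-- The tensor product over `k`, with `A` acting through the coproduct. -/
noncomputable def tensor (X Y : RepFin k A) : RepFin k A where
  V := X.V ⊗[k] Y.V
  ρ := tensorRep X.ρ Y.ρ

/-- The tensor product of two morphisms. -/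
noncomputable def tensorMap {X X' Y Y' : RepFin k A} (f : X ⟶ X') (g : Y ⟶ Y') :
    tensor X Y ⟶ tensor X' Y' where
  toLin := TensorProduct.map f.toLin g.toLin
  comm _ _ := tensorAct_natural _ _ _ _ _ _ f.comm g.comm _ _

variable (k A) in
/-- The tensor unit: the trivial representation on `k`, given by the counit. -/
noncomputable def unit : RepFin k A where
  V := k
  ρ := trivRep k A

/-- The associator `(X ⊗ Y) ⊗ Z ≅ X ⊗ (Y ⊗ Z)` is the action of `Φ⁻¹`, and its inverse
`X ⊗ (Y ⊗ Z) → (X ⊗ Y) ⊗ Z` is the action of `Φ`. The unit isomorphisms are those of vector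
spaces. -/
noncomputable instance : MonoidalCategoryStruct (RepFin k A) where
  tensorObj := tensor
  whiskerLeft X _ _ f := tensorMap (𝟙 X) f
  whiskerRight f Y := tensorMap f (𝟙 Y)
  tensorHom f g := tensorMap f g
  tensorUnit := unit k A
  associator X Y Z := isoMk (X := tensor (tensor X Y) Z) (Y := tensor X (tensor Y Z))
    (assocEquiv X.ρ Y.ρ Z.ρ) (assocEquiv_comm X.ρ Y.ρ Z.ρ)
  leftUnitor X := isoMk (X := tensor (unit k A) X) (Y := X) (TensorProduct.lid k X.V)
    (lid_comm X.ρ)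
  rightUnitor X := isoMk (X := tensor X (unit k A)) (Y := X) (TensorProduct.rid k X.V)
    (rid_comm X.ρ)

noncomputable instance : MonoidalCategory (RepFin k A) where
  tensorHom_def {X₁ Y₁ X₂ Y₂} f g := Hom.ext (by
    change TensorProduct.map f.toLin g.toLin =
      TensorProduct.map LinearMap.id g.toLin ∘ₗ TensorProduct.map f.toLin LinearMap.id
    rw [← TensorProduct.map_comp]; rfl)
  id_tensorHom_id _ _ := Hom.ext TensorProduct.map_id
  tensorHom_comp_tensorHom f₁ f₂ g₁ g₂ := Hom.ext
    (TensorProduct.map_comp g₁.toLin g₂.toLin f₁.toLin f₂.toLin).symm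
  whiskerLeft_id _ _ := Hom.ext TensorProduct.map_id
  id_whiskerRight _ _ := Hom.ext TensorProduct.map_id
  associator_naturality f g h := hom_ext fun v =>
    assocEquiv_natural _ _ _ f.toLin g.toLin h.toLin f.comm g.comm h.comm v
  leftUnitor_naturality {X Y} f := Hom.ext (by
    change (TensorProduct.lid k Y.V).toLinearMap ∘ₗ TensorProduct.map LinearMap.id f.toLin =
      f.toLin ∘ₗ (TensorProduct.lid k X.V).toLinearMap
    ext; simp)
  rightUnitor_naturality {X Y} f := Hom.ext (by
    change (TensorProduct.rid k Y.V).toLinearMap ∘ₗ TensorProduct.map f.toLin LinearMap.id =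
      f.toLin ∘ₗ (TensorProduct.rid k X.V).toLinearMap
    ext; simp)
  pentagon W X Y Z := hom_ext fun v => assocEquiv_pentagon W.ρ X.ρ Y.ρ Z.ρ v
  triangle X Y := hom_ext fun v => assocEquiv_triangle X.ρ Y.ρ v

/-- The dual representation `X*`, with `(a f)(x) = f(S(a) x)`. -/
noncomputable def dual (X : RepFin k A) : RepFin k A where
  V := Module.Dual k X.V
  ρ := dualRep X.ρ

/-- Evaluation `X* ⊗ X → k`, `φ ⊗ x ↦ φ(α x)`, and
coevaluation `k → X ⊗ X*`, `1 ↦ ∑ (β xᵢ) ⊗ xᵢ*`. -/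
noncomputable instance (X : RepFin k A) : ExactPairing X (dual X) where
  coevaluation' := ⟨coevalLin X.ρ, coevalLin_comm X.ρ⟩
  evaluation' := ⟨evalLin X.ρ, evalLin_comm X.ρ⟩
  coevaluation_evaluation' := Hom.ext (by
    apply TensorProduct.ext'
    intro (φ : Module.Dual k X.V) (c : k)
    change TensorProduct.map (evalLin X.ρ) LinearMap.id
      ((assocEquiv (dualRep X.ρ) X.ρ (dualRep X.ρ)).symm (φ ⊗ₜ coevalLin X.ρ c)) =
        (1 : k) ⊗ₜ[k] (c • φ)
    have hc : coevalLin X.ρ c = c • coevalLin X.ρ 1 := by rw [← map_smul, smul_eq_mul, mul_one]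
    rw [hc, TensorProduct.tmul_smul, map_smul, map_smul, evalLin_coevalLin,
      TensorProduct.tmul_smul])
  evaluation_coevaluation' := Hom.ext (by
    apply TensorProduct.ext'
    intro (c : k) (x : X.V)
    change TensorProduct.map LinearMap.id (evalLin X.ρ)
      (assocEquiv X.ρ (dualRep X.ρ) X.ρ (coevalLin X.ρ c ⊗ₜ x)) = (c • x) ⊗ₜ[k] (1 : k)
    have hc : coevalLin X.ρ c = c • coevalLin X.ρ 1 := by rw [← map_smul, smul_eq_mul, mul_one]
    rw [hc, ← TensorProduct.smul_tmul', map_smul, map_smul, coevalLin_evalLin,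
      TensorProduct.smul_tmul'])

/-- Each representation `X` has the dual `X*` with `X* ⊗ X → k` and `k → X ⊗ X*`;
Mathlib calls this a right dual. -/
noncomputable instance : RightRigidCategory (RepFin k A) where
  rightDual X := { rightDual := dual X }

end Monoidal

section Braided

variable {k A : Type u} [Field k] [Ring A] [Algebra k A] [QuasiTriangularQuasiHopfAlgebra k A]

/-- The braiding `u ⊗ v ↦ τ(R (u ⊗ v))`. -/
noncomputable instance : BraidedCategory (RepFin k A) where
  braiding X Y := isoMk (X := tensor X Y) (Y := tensor Y X)
    (braidEquiv X.ρ Y.ρ) (braidEquiv_comm X.ρ Y.ρ)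
  braiding_naturality_right X _ _ f := hom_ext fun v =>
    braidEquiv_natural X.ρ _ LinearMap.id f.toLin (fun _ _ => rfl) f.comm v
  braiding_naturality_left f Z := hom_ext fun v =>
    braidEquiv_natural _ Z.ρ f.toLin LinearMap.id f.comm (fun _ _ => rfl) v
  hexagon_forward X Y Z := hom_ext fun v => braidEquiv_hexagon_forward X.ρ Y.ρ Z.ρ v
  hexagon_reverse X Y Z := hom_ext fun v => braidEquiv_hexagon_reverse X.ρ Y.ρ Z.ρ v

end Braided

end RepFin


section Factorisable

open Limits

variable (C : Type u) [Category.{v} C] [MonoidalCategory C] [RightRigidCategory C]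

/-- The contravariant duality functor `X ↦ X*`, `f ↦ f*`. -/
def dualFunctor : Cᵒᵖ ⥤ C where
  obj X := (X.unop)ᘁ
  map f := (f.unop)ᘁ
  map_id _ := rightAdjointMate_id
  map_comp _ _ := comp_rightAdjointMate

/-- The functor `(U, V) ↦ U* ⊗ V`, `(f, g) ↦ f* ⊗ g`, whose coend is `∫^U U* ⊗ U`. -/
def dualTensorFunctor : Cᵒᵖ ⥤ C ⥤ C :=
  dualFunctor C ⋙ curriedTensor C

variable {C}

/-- The dinatural family `ι_U : U* ⊗ U → L` of a cowedge of `(U, V) ↦ U* ⊗ V`. -/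
def iota (L : Cowedge (dualTensorFunctor C)) (U : C) : Uᘁ ⊗ U ⟶ L.pt :=
  Multicofork.π L U

/-- For an object `L` with dual `L*` and `ω : L ⊗ L → 𝟙`, the morphism
`L → L ⊗ 𝟙 → L ⊗ (L ⊗ L*) → (L ⊗ L) ⊗ L* → 𝟙 ⊗ L* → L*`. -/
def pairingToDual {L : C} (ω : L ⊗ L ⟶ 𝟙_ C) : L ⟶ Lᘁ :=
  (ρ_ L).inv ≫ L ◁ η_ L Lᘁ ≫ (α_ L L Lᘁ).inv ≫ ω ▷ Lᘁ ≫ (λ_ Lᘁ).hom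

variable [BraidedCategory C]

/-- The morphism `(U* ⊗ U) ⊗ (V* ⊗ V) → 𝟙` given by the double braiding of `U` and `V*`
followed by the evaluations of `V` and `U`. -/
def doubleBraidingPairing (U V : C) : (Uᘁ ⊗ U) ⊗ (Vᘁ ⊗ V) ⟶ 𝟙_ C :=
  (α_ Uᘁ U (Vᘁ ⊗ V)).hom ≫ Uᘁ ◁ (α_ U Vᘁ V).inv ≫
    Uᘁ ◁ ((β_ U Vᘁ).hom ≫ (β_ Vᘁ U).hom) ▷ V ≫ Uᘁ ◁ (α_ U Vᘁ V).hom ≫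
      Uᘁ ◁ U ◁ ε_ V Vᘁ ≫ Uᘁ ◁ (ρ_ U).hom ≫ ε_ U Uᘁ

/-- `ω : L ⊗ L → 𝟙` is the canonical Hopf pairing of the coend `L = ∫^U U* ⊗ U`, that is,
`ω ∘ (ι_U ⊗ ι_V)` is the double braiding pairing for all `U` and `V`. -/
def IsCoendPairing (L : Cowedge (dualTensorFunctor C)) (ω : L.pt ⊗ L.pt ⟶ 𝟙_ C) : Prop :=
  ∀ U V : C, (iota L U ⊗ₘ iota L V) ≫ ω = doubleBraidingPairing U V

variable (C) in
/-- A braided category with duals is factorisable if the coend `L = ∫^U U* ⊗ U` exists and its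
canonical Hopf pairing `ω : L ⊗ L → 𝟙` is non-degenerate, that is, the induced morphism `L → L*`
is an isomorphism. (The pair `(L, ω)` is unique up to unique isomorphism.) -/
def IsFactorisable : Prop :=
  ∃ (L : Cowedge (dualTensorFunctor C)) (ω : L.pt ⊗ L.pt ⟶ 𝟙_ C),
    Nonempty (IsColimit L) ∧ IsCoendPairing L ω ∧ IsIso (pairingToDual ω)

end Factorisable

end QuasiHopf

/-! The coend can be made explicit: it is `A*` with the coadjoint action, and `ι_U` sends `f ⊗ u` to
the matrix coefficient `a ↦ f(a u)`. Indeed `u` is the image of `1` under the morphism `A → U`, `a ↦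
a u`, so dinaturality turns the value of any dinatural family at `f ⊗ u` into its value at `f(· u) ⊗
1` in `A* ⊗ A` (`iota_tmul`).

The bridge to `Q = btMap` is the morphism `U* ⊗ U → V ⊗ V*` that creates `V ⊗ V*`, applies the
double braiding of `U` and `V`, and evaluates `U`. A direct computation (`coaction_tmul`) gives `f ⊗
u ↦ ∑ (Q(f(· u)) vᵢ) ⊗ vᵢ*`: the dualities and associators contribute `p`, `Φ⁻¹` and `q̃`, the
braidings contribute `R₂₁ R`. Hence this coaction vanishes on an element of `U* ⊗ U` exactly when
`Q` of its matrix coefficient acts as zero on `V`.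

On the categorical side, the coaction is the transpose of an action `(U* ⊗ U) ⊗ V → V`, and the
double braiding pairing of `U` and `V` is this action on `V*` followed by evaluation. As evaluation
is non-degenerate, a morphism into `U* ⊗ U` is killed by `U* ⊗ U → L → L*` exactly when it is killed
by the coactions at all `V*` (`comp_coendPairingToDual_eq_zero_iff`). An element of `A` that acts as
zero on all duals is zero, because `A` is faithful and `A ≅ A**` is itself isomorphic to a dual. So
under `A* ≅ L` the maps `L → L*` and `Q` have the same kernel (`iota_pairingToDual_eq_zero_iff`).
Each goes between spaces of equal finite dimension, so injectivity decides bijectivity for both.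

The equivalence holds for every coend with its pairing. That the pairing exists on `A*` follows from
dinaturality of the double braiding pairing in both arguments (`doubleBraidingPairing_tmul`). -/

namespace QuasiHopf

open TensorProduct QuasiHopfAlgebra CategoryTheory MonoidalCategory Limits

/-! ### Monodromy action and coaction in a braided category with duals. -/

section Monodromy

variable {C : Type u} [Category.{v} C] [MonoidalCategory C] [RightRigidCategory C]
  [BraidedCategory C]

/-- The action `(U* ⊗ U) ⊗ V → V` given by the double braiding of `U` and `V` followed by the
evaluation of `U`. -/
def monodromyAction (U V : C) : (Uᘁ ⊗ U) ⊗ V ⟶ V :=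
  (α_ Uᘁ U V).hom ≫ Uᘁ ◁ ((β_ U V).hom ≫ (β_ V U).hom) ≫ (α_ Uᘁ U V).inv ≫
    ε_ U Uᘁ ▷ V ≫ (λ_ V).hom

/-- The morphism `U* ⊗ U → V ⊗ V*` that creates the pair `V ⊗ V*`, applies the double braiding
of `U` and `V`, and evaluates `U`. -/
def monodromyCoaction (U V : C) : Uᘁ ⊗ U ⟶ V ⊗ Vᘁ :=
  Uᘁ ◁ (ρ_ U).inv ≫ Uᘁ ◁ U ◁ η_ V Vᘁ ≫ Uᘁ ◁ (α_ U V Vᘁ).inv ≫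
    Uᘁ ◁ ((β_ U V).hom ≫ (β_ V U).hom) ▷ Vᘁ ≫ Uᘁ ◁ (α_ U V Vᘁ).hom ≫
      (α_ Uᘁ U (V ⊗ Vᘁ)).inv ≫ ε_ U Uᘁ ▷ (V ⊗ Vᘁ) ≫ (λ_ (V ⊗ Vᘁ)).hom

/-- By the interchange law, `U` may be evaluated before `V`. This isolates the last evaluation,
whose non-degeneracy is used later. -/
lemma doubleBraidingPairing_eq (U V : C) : doubleBraidingPairing U V =
    (α_ (Uᘁ ⊗ U) Vᘁ V).inv ≫ monodromyAction U Vᘁ ▷ V ≫ ε_ V Vᘁ := by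
  unfold doubleBraidingPairing monodromyAction
  generalize (β_ U Vᘁ).hom ≫ (β_ Vᘁ U).hom = m
  calc
    _ = 𝟙 _ ⊗≫ (Uᘁ : C) ◁ m ▷ V ⊗≫ ((Uᘁ ⊗ U) ◁ ε_ V Vᘁ ≫ ε_ U Uᘁ ▷ 𝟙_ C) ⊗≫ 𝟙 _ := by monoidal
    _ = _ := by rw [whisker_exchange]; monoidal

/-- Action and coaction are transposes of each other under the adjunction between `- ⊗ V` and `- ⊗
V*`; only coherence is involved. -/
lemma tensorRightHomEquiv_monodromyAction (U V : C) :
    tensorRightHomEquiv (Uᘁ ⊗ U) V Vᘁ V (monodromyAction U V) = monodromyCoaction U V := by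
  unfold monodromyCoaction monodromyAction
  generalize (β_ U V).hom ≫ (β_ V U).hom = m
  change (ρ_ _).inv ≫ _ ◁ η_ _ _ ≫ (α_ _ _ _).inv ≫ _ ▷ _ = _
  monoidal

/-- Slide `h*` past the double braiding, turn it into `h` at the evaluation, and slide `h` back by
naturality of the braiding. -/
lemma monodromyAction_dinatural {U U' : C} (h : U ⟶ U') (V : C) :
    (hᘁ ▷ U) ▷ V ≫ monodromyAction U V = (U'ᘁ ◁ h) ▷ V ≫ monodromyAction U' V := by
  have h₁ : h ▷ V ≫ (β_ U' V).hom ≫ (β_ V U').hom =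
      ((β_ U V).hom ≫ (β_ V U).hom) ≫ h ▷ V := by simp
  have h₂ := rightAdjointMate_comp_evaluation h
  unfold monodromyAction
  -- All that is needed of the braiding is the square `h₁`; with the double braidings opaque, the
  -- rest is interchange and associators.
  generalize (β_ U V).hom ≫ (β_ V U).hom = m at *
  generalize (β_ U' V).hom ≫ (β_ V U').hom = m' at *
  calc
    _ = 𝟙 _ ⊗≫ (hᘁ ▷ (U ⊗ V) ≫ Uᘁ ◁ m) ⊗≫ ε_ U Uᘁ ▷ V ⊗≫ 𝟙 _ := by monoidal
    _ = 𝟙 _ ⊗≫ (U'ᘁ : C) ◁ m ⊗≫ (hᘁ ▷ U ≫ ε_ U Uᘁ) ▷ V ⊗≫ 𝟙 _ := by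
      rw [← whisker_exchange]; monoidal
    _ = 𝟙 _ ⊗≫ (U'ᘁ : C) ◁ (m ≫ h ▷ V) ⊗≫ ε_ U' U'ᘁ ▷ V ⊗≫ 𝟙 _ := by
      rw [h₂]; monoidal
    _ = _ := by
      rw [← h₁]; monoidal

lemma monodromyAction_natural (U : C) {V V' : C} (h : V ⟶ V') :
    (Uᘁ ⊗ U) ◁ h ≫ monodromyAction U V' = monodromyAction U V ≫ h := by
  have h₁ : U ◁ h ≫ (β_ U V').hom ≫ (β_ V' U).hom =
      ((β_ U V).hom ≫ (β_ V U).hom) ≫ U ◁ h := by simp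
  unfold monodromyAction
  generalize (β_ U V).hom ≫ (β_ V U).hom = m at *
  generalize (β_ U V').hom ≫ (β_ V' U).hom = m' at *
  calc
    _ = 𝟙 _ ⊗≫ (Uᘁ : C) ◁ (U ◁ h ≫ m') ⊗≫ ε_ U Uᘁ ▷ V' ⊗≫ 𝟙 _ := by monoidal
    _ = 𝟙 _ ⊗≫ (Uᘁ : C) ◁ m ⊗≫ ((Uᘁ ⊗ U) ◁ h ≫ ε_ U Uᘁ ▷ V') ⊗≫ 𝟙 _ := by rw [h₁]; monoidal
    _ = _ := by rw [whisker_exchange]; monoidal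

lemma doubleBraidingPairing_dinatural_left {U U' : C} (h : U ⟶ U') (V : C) :
    (hᘁ ▷ U) ▷ (Vᘁ ⊗ V) ≫ doubleBraidingPairing U V =
      (U'ᘁ ◁ h) ▷ (Vᘁ ⊗ V) ≫ doubleBraidingPairing U' V := by
  rw [doubleBraidingPairing_eq, doubleBraidingPairing_eq, associator_inv_naturality_left_assoc,
    associator_inv_naturality_left_assoc, ← comp_whiskerRight_assoc, monodromyAction_dinatural,
    comp_whiskerRight_assoc]

/-- Naturality of the action on `V*` lets `h*` reach the evaluation, where it becomes `h` on the
other factor. -/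
lemma doubleBraidingPairing_dinatural_right (U : C) {V V' : C} (h : V ⟶ V') :
    (Uᘁ ⊗ U) ◁ (hᘁ ▷ V) ≫ doubleBraidingPairing U V =
      (Uᘁ ⊗ U) ◁ (V'ᘁ ◁ h) ≫ doubleBraidingPairing U V' := by
  rw [doubleBraidingPairing_eq, doubleBraidingPairing_eq, associator_inv_naturality_middle_assoc,
    associator_inv_naturality_right_assoc, ← comp_whiskerRight_assoc, monodromyAction_natural,
    comp_whiskerRight_assoc, whisker_exchange_assoc, rightAdjointMate_comp_evaluation]

end Monodromy

section Braiding

variable {k : Type u} {A : Type v} [Field k] [Ring A] [Algebra k A]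
  [QuasiTriangularQuasiHopfAlgebra k A] {U V : Type*}
  [AddCommGroup U] [Module k U] [AddCommGroup V] [Module k V]
  (ρ : A →ₐ[k] Module.End k U) (σ : A →ₐ[k] Module.End k V)

lemma braidEquiv_braidEquiv (x : U ⊗[k] V) :
    braidEquiv σ ρ (braidEquiv ρ σ x) =
      tensorAct ρ σ (swapTensor k A (RMat k A) * RMat k A) x := by
  rw [braidEquiv_apply, braidEquiv_apply, tensorAct_comm, map_mul, Module.End.mul_apply,
    ← LinearEquiv.trans_apply]
  simp [swapTensor]

end Braiding

/-! ### The action of `A ⊗ A ⊗ A` on `A ⊗ A` through `closeUp`. -/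

section CloseUp

variable {k : Type u} {A : Type v} [Field k] [Ring A] [Algebra k A]

lemma closeUp_tmul_eq (S : A →ₗ[k] A) (N : A ⊗[k] A) (a b c : A) :
    closeUp S N (a ⊗ₜ (b ⊗ₜ c)) = (a ⊗ₜ b) * N * (1 ⊗ₜ S c) := by
  simp [closeUp]

lemma closeUp_add (S : A →ₗ[k] A) (N N' : A ⊗[k] A) (X : A ⊗[k] (A ⊗[k] A)) :
    closeUp S (N + N') X = closeUp S N X + closeUp S N' X := by
  induction X with
  | zero => simp
  | add X Y hX hY => rw [map_add, map_add, map_add, hX, hY]; abel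
  | tmul a Y =>
    induction Y with
    | zero => simp
    | add X Y hX hY => simp only [TensorProduct.tmul_add, map_add, hX, hY]; abel
    | tmul b c => simp only [closeUp_tmul_eq, mul_add, add_mul]

lemma closeUp_zero (S : A →ₗ[k] A) (X : A ⊗[k] (A ⊗[k] A)) : closeUp S 0 X = 0 := by
  simpa using closeUp_add S 0 0 X

/-- The third leg multiplies on the right through `S`; as `S` reverses products, this is a left
action. It merges the successive actions of `Φ⁻¹` and of `q̃` in the computation of the coaction. -/
lemma closeUp_mul {S : A →ₗ[k] A} (hS : ∀ a b, S (a * b) = S b * S a) (N : A ⊗[k] A)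
    (X Y : A ⊗[k] (A ⊗[k] A)) : closeUp S N (X * Y) = closeUp S (closeUp S N Y) X := by
  induction X with
  | zero => simp
  | add X X' h h' => simp only [add_mul, map_add, h, h']
  | tmul a X =>
    induction X with
    | zero => simp
    | add X X' h h' => simp only [add_mul, TensorProduct.tmul_add, map_add, h, h']
    | tmul b c =>
      induction Y with
      | zero => simp [closeUp_zero]
      | add Y Y' h h' => simp only [mul_add, map_add, closeUp_add, h, h']
      | tmul a' Y =>
        induction Y with
        | zero => simp [closeUp_zero]
        | add Y Y' h h' => simp only [mul_add, TensorProduct.tmul_add, map_add, closeUp_add, h, h']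
        | tmul b' c' =>
          have e : (1 : A) ⊗ₜ[k] S (c * c') = (1 ⊗ₜ[k] S c') * (1 ⊗ₜ[k] S c) := by simp [hS]
          have e' : (a * a') ⊗ₜ[k] (b * b') = (a ⊗ₜ[k] b) * (a' ⊗ₜ[k] b') := by simp
          simp only [Algebra.TensorProduct.tmul_mul_tmul, closeUp_tmul_eq]
          rw [e, e']
          simp only [mul_assoc]

end CloseUp

/-! ### Computation of the coaction in terms of `btMap`. -/

section Coevaluation

variable {k : Type u} {A : Type v} [Field k] [Ring A] [Algebra k A]
  {U V W : Type*} [AddCommGroup U] [Module k U] [AddCommGroup V] [Module k V]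
  [FiniteDimensional k V] [AddCommGroup W] [Module k W]

/-- The linear map `a ↦ a u`. -/
def orbitMap (ρ : A →ₐ[k] Module.End k U) (u : U) : A →ₗ[k] U :=
  LinearMap.applyₗ u ∘ₗ ρ.toLinearMap

@[simp] lemma orbitMap_apply (ρ : A →ₐ[k] Module.End k U) (u : U) (a : A) :
    orbitMap ρ u a = ρ a u := rfl

/-- The linear map `a ↦ ∑ (a vᵢ) ⊗ vᵢ*`. -/
noncomputable def coevalAct (σ : A →ₐ[k] Module.End k V) : A →ₗ[k] V ⊗[k] Module.Dual k V :=
  LinearMap.applyₗ (coevaluation k V 1) ∘ₗ LinearMap.rTensorHom (Module.Dual k V) ∘ₗ σ.toLinearMap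

lemma coevalAct_apply (σ : A →ₐ[k] Module.End k V) (a : A) :
    coevalAct σ a = TensorProduct.map (σ a) LinearMap.id (coevaluation k V 1) := rfl

lemma lTensor_contractLeft_coevaluation (v : V) :
    (contractLeft k V).lTensor V (TensorProduct.assoc k _ _ _ (coevaluation k V 1 ⊗ₜ v)) =
      v ⊗ₜ 1 := by
  have := LinearMap.congr_fun (contractLeft_assoc_coevaluation' k V) (1 ⊗ₜ v)
  simpa using! this

/-- Contracting `∑ (a vᵢ) ⊗ vᵢ*` with a vector `v` gives back `a v`: this is the isomorphism of `End
V` with `V ⊗ V*`. -/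
lemma coevalAct_eq_zero_iff (σ : A →ₐ[k] Module.End k V) (a : A) :
    coevalAct σ a = 0 ↔ σ a = 0 := by
  constructor
  · intro h
    ext v
    have e : ∀ w : V ⊗[k] Module.Dual k V, (contractLeft k V).lTensor V
        (TensorProduct.assoc k _ _ _ (TensorProduct.map (σ a) LinearMap.id w ⊗ₜ v)) =
        TensorProduct.map (σ a) LinearMap.id ((contractLeft k V).lTensor V
          (TensorProduct.assoc k _ _ _ (w ⊗ₜ v))) := by
      intro w
      induction w with
      | zero => simp
      | add x y hx hy => simp only [map_add, hx, hy, TensorProduct.add_tmul]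
      | tmul v ψ => simp
    have h₁ := e (coevaluation k V 1)
    rw [← coevalAct_apply, h, lTensor_contractLeft_coevaluation] at h₁
    have h₂ := congrArg (TensorProduct.rid k V) h₁
    simpa using h₂.symm
  · intro h
    rw [coevalAct_apply, h, TensorProduct.map_zero_left, LinearMap.zero_apply]

section OrbitCoevalAct

variable (ρ : A →ₐ[k] Module.End k U) (σ : A →ₐ[k] Module.End k V)

/-- The linear map `a ⊗ b ↦ ∑ (a u) ⊗ (b vᵢ ⊗ vᵢ*)`. -/
noncomputable def orbitCoevalAct (u : U) : A ⊗[k] A →ₗ[k] U ⊗[k] (V ⊗[k] Module.Dual k V) :=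
  TensorProduct.map (orbitMap ρ u) (coevalAct σ)

lemma map_tensorAct_orbitCoevalAct (u : U) (M N : A ⊗[k] A) :
    TensorProduct.map (tensorAct ρ σ M) LinearMap.id
        ((TensorProduct.assoc k _ _ _).symm (orbitCoevalAct ρ σ u N)) =
      (TensorProduct.assoc k _ _ _).symm (orbitCoevalAct ρ σ u (M * N)) := by
  induction N with
  | zero => simp
  | add N N' h h' => simp only [map_add, mul_add, h, h']
  | tmul n₁ n₂ =>
    induction M with
    | zero => simp
    | add X Y hX hY =>
      simp only [map_add, LinearMap.add_apply, hX, hY, TensorProduct.map_add_left, add_mul]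
    | tmul a b =>
      simp only [orbitCoevalAct, TensorProduct.map_tmul, Algebra.TensorProduct.tmul_mul_tmul,
        tensorAct_tmul, coevalAct_apply, orbitMap_apply, map_mul]
      generalize coevaluation k V 1 = w
      induction w with
      | zero => simp
      | add x y hx hy => simp only [map_add, hx, hy, TensorProduct.tmul_add]
      | tmul v ψ => simp

lemma lid_map_orbitCoevalAct (f : Module.Dual k U) (u : U) (N : A ⊗[k] A) :
    TensorProduct.lid k _ (TensorProduct.map f LinearMap.id (orbitCoevalAct ρ σ u N)) =
      coevalAct σ (TensorProduct.lid k A (LinearMap.rTensor A (f ∘ₗ orbitMap ρ u) N)) := by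
  induction N with
  | zero => simp
  | add N N' h h' => simp only [map_add, h, h']
  | tmul n₁ n₂ => simp [orbitCoevalAct]

end OrbitCoevalAct

section QuasiHopf

variable [QuasiHopfAlgebra k A] (ρ : A →ₐ[k] Module.End k U) (σ : A →ₐ[k] Module.End k V)

/-- An operator on `V*` crosses the coevaluation as its transpose on `V`, so `b` becomes right
multiplication by `S(b)`. -/
lemma map_coevalAct (a b z : A) :
    TensorProduct.map (σ a) (dualRep σ b) (coevalAct σ z) =
      coevalAct σ (a * z * antipode (k := k) b) := by
  have e : TensorProduct.map (σ a) (dualRep σ b) ∘ₗ TensorProduct.map (σ z) LinearMap.id =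
      TensorProduct.map (σ (a * z)) LinearMap.id ∘ₗ
        TensorProduct.map LinearMap.id (σ (antipode (k := k) b)).dualMap := by
    rw [← TensorProduct.map_comp, ← TensorProduct.map_comp, map_mul]
    rfl
  rw [coevalAct_apply, coevalAct_apply]
  refine (LinearMap.congr_fun e _).trans ?_
  rw [LinearMap.comp_apply, coevaluation_dualMap, ← LinearMap.comp_apply,
    ← TensorProduct.map_comp, map_mul σ (a * z)]
  rfl

/-- This is why `closeUp` appears in the definition of `btElement`: associators on `U ⊗ V ⊗ V*`
become operations on elements of `A ⊗ A`, independent of `U` and `V`. -/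
lemma tensorAct_orbitCoevalAct (u : U) (X : A ⊗[k] (A ⊗[k] A)) (N : A ⊗[k] A) :
    tensorAct ρ (tensorAct σ (dualRep σ)) X (orbitCoevalAct ρ σ u N) =
      orbitCoevalAct ρ σ u (closeUp (antipode (k := k)) N X) := by
  induction N with
  | zero => simp [closeUp_zero]
  | add N N' h h' =>
    rw [closeUp_add, map_add, map_add, map_add, h, h']
  | tmul n₁ n₂ =>
    induction X with
    | zero => simp
    | add X Y hX hY => simp only [map_add, LinearMap.add_apply, hX, hY]
    | tmul a Y =>
      induction Y with
      | zero => simp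
      | add X Y hX hY => simp only [TensorProduct.tmul_add, map_add, LinearMap.add_apply, hX, hY]
      | tmul b c =>
        rw [closeUp_tmul]
        simp only [orbitCoevalAct, TensorProduct.map_tmul, tensorAct_tmul, map_coevalAct]
        simp

lemma tmul_coevalLin_one (u : U) :
    u ⊗ₜ coevalLin σ 1 = orbitCoevalAct ρ σ u (1 ⊗ₜ[k] coevalElt k) := by
  simp [orbitCoevalAct, coevalAct_apply, coevalLin]

/-- For `X = Φ` the right-hand side is `p`. -/
lemma closeUp_one_tmul_coevalElt (X : A ⊗[k] (A ⊗[k] A)) :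
    closeUp (antipode (k := k)) (1 ⊗ₜ[k] coevalElt k) X =
      TensorProduct.map LinearMap.id (coevalMap (antipode (k := k)) (coevalElt k)) X := by
  induction X with
  | zero => simp
  | add X Y hX hY => simp only [map_add, hX, hY]
  | tmul a Y =>
    induction Y with
    | zero => simp
    | add X Y hX hY => simp only [TensorProduct.tmul_add, map_add, hX, hY]
    | tmul b c => simp [closeUp_tmul]

/-- For `Y = Φ` the element acting on the right-hand side is `q̃`: evaluation after the associator
puts `S(Φ₁) α Φ₂` on `U` and leaves `Φ₃` on `W`. -/
lemma lid_map_evalLin_tensorAct (τ : A →ₐ[k] Module.End k W) (f : Module.Dual k U)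
    (Y : A ⊗[k] (A ⊗[k] A)) (w : U ⊗[k] W) :
    TensorProduct.lid k W (TensorProduct.map (evalLin ρ) LinearMap.id
      ((TensorProduct.assoc k _ _ _).symm
        (tensorAct (dualRep ρ) (tensorAct ρ τ) Y (f ⊗ₜ w)))) =
      TensorProduct.lid k W (TensorProduct.map f LinearMap.id (tensorAct ρ τ
        (TensorProduct.map (evalMap (antipode (k := k)) (evalElt k)) LinearMap.id
          ((TensorProduct.assoc k A A A).symm Y)) w)) := by
  induction w with
  | zero => simp
  | add x y hx hy => simp only [map_add, hx, hy, TensorProduct.tmul_add]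
  | tmul u t =>
    induction Y with
    | zero => simp
    | add X Y hX hY => simp only [map_add, LinearMap.add_apply, hX, hY]
    | tmul a Y =>
      induction Y with
      | zero => simp
      | add X Y hX hY => simp only [TensorProduct.tmul_add, map_add, LinearMap.add_apply, hX, hY]
      | tmul b c => simp [evalLin_tmul, dualRep_apply]

end QuasiHopf

section Braiding

variable [QuasiTriangularQuasiHopfAlgebra k A] (ρ : A →ₐ[k] Module.End k U)
  (σ : A →ₐ[k] Module.End k V)

/-- Start from `u ⊗ coev(1)`, which corresponds to `1 ⊗ β`. The first associator turns it into `p`,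
the double braiding multiplies it by `R₂₁ R`, the next associator acts by `Φ⁻¹`, and the evaluation
of `U` yields `q̃`. The second leg of `q̃` acts on `V ⊗ V*` and hence through `Δ`. The result is
`btElement`, with `f(· u)` applied to its first leg. -/
lemma coaction_tmul (f : Module.Dual k U) (u : U) :
    TensorProduct.lid k _ (TensorProduct.map (evalLin ρ) LinearMap.id
      ((assocEquiv (dualRep ρ) ρ (tensorRep σ (dualRep σ))).symm
        (f ⊗ₜ (assocEquiv ρ σ (dualRep σ) (TensorProduct.map
          ((braidEquiv σ ρ).toLinearMap ∘ₗ (braidEquiv ρ σ).toLinearMap) LinearMap.id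
            ((assocEquiv ρ σ (dualRep σ)).symm (u ⊗ₜ coevalLin σ 1))))))) =
      coevalAct σ (btMap k A (f ∘ₗ orbitMap ρ u)) := by
  have h : (braidEquiv σ ρ).toLinearMap ∘ₗ (braidEquiv ρ σ).toLinearMap =
      tensorAct ρ σ (swapTensor k A (RMat k A) * RMat k A) :=
    LinearMap.ext (braidEquiv_braidEquiv ρ σ)
  rw [h, tmul_coevalLin_one ρ, assocEquiv_symm_apply ρ, tensorAct_orbitCoevalAct,
    closeUp_one_tmul_coevalElt, map_tensorAct_orbitCoevalAct, assocEquiv_apply,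
    LinearEquiv.apply_symm_apply, tensorAct_orbitCoevalAct, assocEquiv_symm_apply,
    lid_map_evalLin_tensorAct, tensorRep, tensorAct_comp_right, tensorAct_orbitCoevalAct,
    ← closeUp_mul antipode_mul, lid_map_orbitCoevalAct]
  rfl

end Braiding

end Coevaluation

namespace RepFin

/-! ### Kernels, isomorphisms and the regular representation. -/

section Category

variable {k A : Type u} [Field k] [Ring A] [Algebra k A]

lemma comp_toLin_apply {X Y Z : RepFin k A} (f : X ⟶ Y) (g : Y ⟶ Z) (x : X.V) :
    (f ≫ g).toLin x = g.toLin (f.toLin x) := rfl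

/-- The category of representations has zero morphisms, namely the zero linear maps. -/
instance : HasZeroMorphisms (RepFin k A) where
  zero _ _ := ⟨⟨0, fun _ _ => by simp⟩⟩
  comp_zero _ _ := rfl
  zero_comp _ _ _ f := hom_ext fun _ => map_zero f.toLin

lemma eq_zero_iff {X Y : RepFin k A} (f : X ⟶ Y) : f = 0 ↔ ∀ x, f.toLin x = 0 :=
  ⟨fun h x => by rw [h]; rfl, fun h => hom_ext h⟩

/-- The kernel of a morphism of representations. -/
def kernelRep {X Y : RepFin k A} (f : X ⟶ Y) : RepFin k A where
  V := LinearMap.ker f.toLin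
  ρ := AlgHom.ofLinearMap
    { toFun := fun a => (X.ρ a).restrict fun x hx => by
        rw [LinearMap.mem_ker] at hx ⊢
        rw [f.comm, hx, map_zero]
      map_add' := fun a b => by ext; simp
      map_smul' := fun c a => by ext; simp }
    (by ext; simp)
    (fun a b => by ext; simp)

/-- The inclusion of the kernel. -/
def kernelIncl {X Y : RepFin k A} (f : X ⟶ Y) : kernelRep f ⟶ X where
  toLin := (LinearMap.ker f.toLin).subtype
  comm _ _ := rfl

lemma kernelIncl_comp {X Y : RepFin k A} (f : X ⟶ Y) : kernelIncl f ≫ f = 0 :=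
  hom_ext fun x => x.2

/-- Converts vanishing of composites of morphisms into an inclusion of kernels of linear maps, since
the kernel is a subrepresentation. -/
lemma apply_eq_zero_of_comp {X Y Z : RepFin k A} (f : X ⟶ Y) (g : X ⟶ Z)
    (h : kernelIncl f ≫ g = 0) {x : X.V} (hx : f.toLin x = 0) : g.toLin x = 0 :=
  (eq_zero_iff _).1 h (⟨x, hx⟩ : LinearMap.ker f.toLin)

lemma isIso_iff_bijective {X Y : RepFin k A} (f : X ⟶ Y) :
    IsIso f ↔ Function.Bijective f.toLin := by
  constructor
  · intro h
    refine Function.bijective_iff_has_inverse.2 ⟨(inv f).toLin, fun x => ?_, fun x => ?_⟩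
    · rw [← comp_toLin_apply, IsIso.hom_inv_id]; rfl
    · rw [← comp_toLin_apply, IsIso.inv_hom_id]; rfl
  · intro h
    exact (isoMk (LinearEquiv.ofBijective f.toLin h) f.comm).isIso_hom

/-- The left regular representation. -/
def regular (k A : Type u) [Field k] [Ring A] [Algebra k A] [FiniteDimensional k A] :
    RepFin k A where
  V := A
  ρ := Algebra.lmul k A

/-- The morphism `A → U`, `a ↦ a u`. -/
def orbitHom [FiniteDimensional k A] (U : RepFin k A) (u : U.V) : regular k A ⟶ U where
  toLin := orbitMap (A := A) U.ρ u
  comm a b := LinearMap.congr_fun (map_mul U.ρ a (show A from b)) u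

lemma orbitHom_one [FiniteDimensional k A] (U : RepFin k A) (u : U.V) :
    (orbitHom U u).toLin (1 : A) = u := by
  change U.ρ (1 : A) u = u
  rw [map_one]; rfl

end Category

/-! ### Transposition of morphisms and duals of morphisms. -/

section Monoidal

variable {k A : Type u} [Field k] [Ring A] [Algebra k A] [QuasiHopfAlgebra k A]

lemma hom_ext_tmul {X Y Z : RepFin k A} {f g : X ⊗ Y ⟶ Z}
    (h : ∀ (x : X.V) (y : Y.V), f.toLin (x ⊗ₜ[k] y) = g.toLin (x ⊗ₜ[k] y)) : f = g :=
  Hom.ext (TensorProduct.ext' h)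

lemma zero_whiskerRight {X Y : RepFin k A} (Z : RepFin k A) : (0 : X ⟶ Y) ▷ Z = 0 :=
  hom_ext_tmul fun _ z => TensorProduct.zero_tmul _ z

lemma tensorRightHomEquiv_eq_zero_iff {X Y Y' Z : RepFin k A} [ExactPairing Y Y']
    (f : X ⊗ Y ⟶ Z) : tensorRightHomEquiv X Y Y' Z f = 0 ↔ f = 0 := by
  have h : tensorRightHomEquiv X Y Y' Z 0 = 0 := by
    change (ρ_ _).inv ≫ _ ◁ η_ _ _ ≫ (α_ _ _ _).inv ≫ (0 : X ⊗ Y ⟶ Z) ▷ _ = 0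
    simp only [zero_whiskerRight, comp_zero]
  rw [← (tensorRightHomEquiv X Y Y' Z).apply_eq_iff_eq (x := f) (y := 0), h]

lemma comp_tensorRightHomEquiv {X X' Y Y' Z : RepFin k A} [ExactPairing Y Y']
    (j : X' ⟶ X) (f : X ⊗ Y ⟶ Z) :
    j ≫ tensorRightHomEquiv X Y Y' Z f = tensorRightHomEquiv X' Y Y' Z (j ▷ Y ≫ f) := by
  apply (tensorRightHomEquiv X' Y Y' Z).symm.injective
  rw [tensorRightHomEquiv_symm_naturality, Equiv.symm_apply_apply, Equiv.symm_apply_apply]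

/-- The categorical transpose is determined by its compatibility with evaluation. The linear
transpose satisfies the same identity, as `f` commutes with the action of `α`. -/
lemma rightAdjointMate_toLin {X Y : RepFin k A} (f : X ⟶ Y) : (fᘁ).toLin = f.toLin.dualMap := by
  let g : (Yᘁ : RepFin k A) ⟶ Xᘁ :=
    { toLin := f.toLin.dualMap
      comm := fun a φ => LinearMap.ext fun x => 
        congrArg (show Module.Dual k Y.V from φ) (f.comm (antipode (k := k) a) x).symm }
  have h : g ▷ X ≫ ε_ X Xᘁ = (fᘁ) ▷ X ≫ ε_ X Xᘁ := by
    rw [rightAdjointMate_comp_evaluation]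
    refine hom_ext_tmul fun (φ : Module.Dual k Y.V) x => ?_
    change evalLin X.ρ (f.toLin.dualMap φ ⊗ₜ x) = evalLin Y.ρ (φ ⊗ₜ f.toLin x)
    rw [evalLin_tmul, evalLin_tmul, LinearMap.dualMap_apply, f.comm]
  have h' := congrArg (tensorRightHomEquiv _ X Xᘁ (𝟙_ (RepFin k A))) h
  rw [tensorRightHomEquiv_whiskerRight_comp_evaluation,
    tensorRightHomEquiv_whiskerRight_comp_evaluation] at h'
  have h'' : g = fᘁ := by
    rw [← cancel_mono (λ_ _).inv]; exact h'
  rw [← h'']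

end Monoidal

/-! ### Matrix coefficients and the coend as the coadjoint representation. -/

section MatrixCoeff

variable {k A : Type u} [Field k] [Ring A] [Algebra k A]

/-- The linear map `U* ⊗ U → A*` that sends `f ⊗ u` to the matrix coefficient `a ↦ f(a u)`. -/
noncomputable def matrixCoeff {U : Type*} [AddCommGroup U] [Module k U]
    (ρ : A →ₐ[k] Module.End k U) : Module.Dual k U ⊗[k] U →ₗ[k] Module.Dual k A :=
  TensorProduct.lift (LinearMap.mk₂ k (fun f u => f ∘ₗ orbitMap ρ u)
    (fun _ _ _ => by ext; simp) (fun _ _ _ => by ext; simp) (fun _ _ _ => by ext; simp)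
    (fun _ _ _ => by ext; simp))

lemma matrixCoeff_tmul {U : Type*} [AddCommGroup U] [Module k U]
    (ρ : A →ₐ[k] Module.End k U) (f : Module.Dual k U) (u : U) :
    matrixCoeff ρ (f ⊗ₜ u) = f ∘ₗ orbitMap ρ u := rfl

lemma matrixCoeff_regular_tmul_one (φ : Module.Dual k A) :
    matrixCoeff (Algebra.lmul k A) (φ ⊗ₜ 1) = φ := by
  ext a
  simp [matrixCoeff_tmul]

end MatrixCoeff

section Coend

variable {k A : Type u} [Field k] [Ring A] [Algebra k A] [QuasiHopfAlgebra k A]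

variable (k A) in
/-- The action of `A ⊗ A` on `A*` given by `((b ⊗ c) φ)(a) = φ(S(b) a c)`. -/
noncomputable def dualBimoduleRep : A ⊗[k] A →ₐ[k] Module.End k (Module.Dual k A) :=
  Algebra.TensorProduct.lift (dualRep (Algebra.lmul k A))
    (AlgHom.ofLinearMap
      { toFun := fun c => (LinearMap.mulRight k c).dualMap
        map_add' := fun a b => by ext; simp [mul_add]
        map_smul' := fun c a => by ext; simp }
      (by ext; simp) (fun a b => by ext; simp [mul_assoc]))
    (fun b c => by
      change _ * _ = _ * _
      ext φ a
      simp [dualRep_apply, mul_assoc])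

lemma dualBimoduleRep_tmul (b c : A) (φ : Module.Dual k A) (a : A) :
    dualBimoduleRep k A (b ⊗ₜ c) φ a = φ (antipode (k := k) b * a * c) := by
  simp [dualBimoduleRep, dualRep_apply, mul_assoc]

lemma matrixCoeff_tensorAct {U : Type*} [AddCommGroup U] [Module k U]
    (ρ : A →ₐ[k] Module.End k U) (X : A ⊗[k] A) (x : Module.Dual k U ⊗[k] U) :
    matrixCoeff ρ (tensorAct (dualRep ρ) ρ X x) = dualBimoduleRep k A X (matrixCoeff ρ x) := by
  induction x with
  | zero => simp
  | add x y hx hy => simp only [map_add, hx, hy]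
  | tmul f u =>
    induction X with
    | zero => simp
    | add X Y hX hY => simp only [map_add, LinearMap.add_apply, hX, hY]
    | tmul b c =>
      ext a
      simp [matrixCoeff_tmul, dualBimoduleRep_tmul, dualRep_apply]

lemma iota_dinatural (L : Cowedge (dualTensorFunctor (RepFin k A))) {U V : RepFin k A}
    (h : U ⟶ V) : (hᘁ) ▷ U ≫ iota L U = Vᘁ ◁ h ≫ iota L V :=
  Cowedge.condition L h

variable [FiniteDimensional k A]

variable (k A) in
/-- The coadjoint representation on `A*`, `(b φ)(a) = ∑ φ(S(b') a b'')`. -/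
noncomputable def coadjoint : RepFin k A where
  V := Module.Dual k A
  ρ := (dualBimoduleRep k A).comp comul

/-- The morphism `U* ⊗ U → A*` that sends `f ⊗ u` to the matrix coefficient `a ↦ f(a u)`. -/
noncomputable def matrixCoeffHom (U : RepFin k A) : Uᘁ ⊗ U ⟶ coadjoint k A where
  toLin := matrixCoeff U.ρ
  comm a x := matrixCoeff_tensorAct U.ρ (comul a) x

variable (k A) in
/-- The coadjoint representation with the matrix coefficient maps. -/
noncomputable def coadjointCowedge : Cowedge (dualTensorFunctor (RepFin k A)) :=
  Cowedge.mk (coadjoint k A) matrixCoeffHom fun U V h => by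
    refine hom_ext_tmul fun (f : Module.Dual k V.V) (u : U.V) => ?_
    change matrixCoeff U.ρ ((hᘁ).toLin f ⊗ₜ u) = matrixCoeff V.ρ (f ⊗ₜ h.toLin u)
    rw [rightAdjointMate_toLin]
    ext a
    change f (h.toLin (U.ρ a u)) = f (V.ρ a (h.toLin u))
    rw [h.comm]

/-- A family that is dinatural in `U* ⊗ U` is determined by its value on `A* ⊗ 1`. -/
lemma iota_tmul (L : Cowedge (dualTensorFunctor (RepFin k A))) (U : RepFin k A)
    (f : Module.Dual k U.V) (u : U.V) :
    (iota L U).toLin (f ⊗ₜ[k] u) =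
      (iota L (regular k A)).toLin (matrixCoeff U.ρ (f ⊗ₜ u) ⊗ₜ[k] (1 : A)) := by
  -- Dinaturality for `A → U`, `a ↦ a u`, evaluated at `f ⊗ 1`: the transpose sends `f` to the
  -- matrix coefficient, and `1` goes to `u`.
  have h := congrArg (fun g => g.toLin (f ⊗ₜ[k] (1 : A))) (iota_dinatural L (orbitHom U u))
  have h₁ : (iota L (regular k A)).toLin (((orbitHom U u)ᘁ).toLin f ⊗ₜ[k] (1 : A)) =
    (iota L U).toLin (f ⊗ₜ[k] (orbitHom U u).toLin (1 : A)) := h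
  rw [orbitHom_one, rightAdjointMate_toLin] at h₁
  exact h₁.symm

/-- The morphism from the coadjoint representation to the vertex of a cowedge. -/
noncomputable def coadjointDesc (L : Cowedge (dualTensorFunctor (RepFin k A))) :
    coadjoint k A ⟶ L.pt where
  toLin := (iota L (regular k A)).toLin ∘ₗ (TensorProduct.mk k (Module.Dual k A) A).flip 1
  comm a (φ : Module.Dual k A) := by
    let F : Module.Dual k A ⊗[k] A →ₗ[k] L.pt.V := (iota L (regular k A)).toLin
    -- `φ ↦ φ ⊗ 1` need not be `A`-linear, but `F` depends only on matrix coefficients, on which `A`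
    -- acts by the coadjoint action.
    have key : ∀ x, F x = F (matrixCoeff (Algebra.lmul k A) x ⊗ₜ[k] (1 : A)) := by
      intro x
      induction x with
      | zero => simp
      | add x y hx hy => rw [map_add, hx, hy, map_add, TensorProduct.add_tmul, map_add]
      | tmul f b => exact iota_tmul L (regular k A) f b
    have h : F (tensorAct (dualRep (Algebra.lmul k A)) (Algebra.lmul k A) (comul (k := k) a)
        (φ ⊗ₜ[k] (1 : A))) = L.pt.ρ a (F (φ ⊗ₜ[k] (1 : A))) :=
      (iota L (regular k A)).comm a (φ ⊗ₜ[k] (1 : A))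
    rw [key, matrixCoeff_tensorAct, matrixCoeff_regular_tmul_one] at h
    exact h

lemma matrixCoeffHom_coadjointDesc (L : Cowedge (dualTensorFunctor (RepFin k A)))
    (U : RepFin k A) : matrixCoeffHom U ≫ coadjointDesc L = iota L U :=
  hom_ext_tmul fun f u => (iota_tmul L U f u).symm

variable (k A) in
/-- The coadjoint representation is the coend of `U* ⊗ U`. -/
noncomputable def isColimitCoadjointCowedge : IsColimit (coadjointCowedge k A) :=
  Multicofork.IsColimit.mk _ coadjointDesc (fun L U => matrixCoeffHom_coadjointDesc L U)
    (fun L m hm => hom_ext (X := coadjoint k A) fun (φ : Module.Dual k A) => by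
      let F : Module.Dual k A →ₗ[k] L.pt.V := m.toLin
      -- Uniqueness: every `φ` is the matrix coefficient of `φ ⊗ 1`.
      have h : F (matrixCoeff (Algebra.lmul k A) (φ ⊗ₜ 1)) =
          (iota L (regular k A)).toLin (φ ⊗ₜ[k] (1 : A)) :=
        congrArg (fun g => g.toLin (φ ⊗ₜ[k] (1 : A))) (hm (regular k A))
      rwa [matrixCoeff_regular_tmul_one] at h)

end Coend

lemma regular_rho_eq_zero_iff {k A : Type u} [Field k] [Ring A] [Algebra k A] [FiniteDimensional k A]
    (a : A) : (regular k A).ρ a = 0 ↔ a = 0 := by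
  constructor
  · intro h
    have h₁ : a * 1 = 0 := LinearMap.congr_fun h (1 : A)
    rwa [mul_one] at h₁
  · rintro rfl
    exact map_zero _

/-! ### Non-degeneracy of evaluation and the kernel of `L → L*`. -/

section Pairing

variable {k A : Type u} [Field k] [Ring A] [Algebra k A] [QuasiHopfAlgebra k A]

lemma whiskerRight_comp_evaluation_eq_zero_iff {X N : RepFin k A} (g : N ⟶ Xᘁ) :
    g ▷ X ≫ ε_ X Xᘁ = 0 ↔ g = 0 := by
  rw [← tensorRightHomEquiv_eq_zero_iff (Y' := Xᘁ),
    tensorRightHomEquiv_whiskerRight_comp_evaluation, ← zero_comp (f := (λ_ (Xᘁ : RepFin k A)).inv),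
    cancel_mono]

/-- `pairingToDual ω` is the transpose of `ω` up to the left unit isomorphism, and transposition is
a natural bijection that preserves zero. -/
lemma comp_pairingToDual_eq_zero_iff {L N : RepFin k A} (ω : L ⊗ L ⟶ 𝟙_ (RepFin k A))
    (j : N ⟶ L) : j ≫ pairingToDual ω = 0 ↔ j ▷ L ≫ ω = 0 := by
  have h : pairingToDual ω = tensorRightHomEquiv L L Lᘁ _ ω ≫ (λ_ Lᘁ).hom := by
    simp [pairingToDual, tensorRightHomEquiv]
  rw [h, ← Category.assoc, comp_tensorRightHomEquiv, ← zero_comp (f := (λ_ (Lᘁ : RepFin k A)).hom),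
    cancel_mono, tensorRightHomEquiv_eq_zero_iff]

lemma isIso_iff_injective_of_dual {L : RepFin k A} (f : L ⟶ Lᘁ) :
    IsIso f ↔ Function.Injective f.toLin := by
  let F : L.V →ₗ[k] Module.Dual k L.V := f.toLin
  have h : Function.Injective F ↔ Function.Surjective F :=
    LinearMap.injective_iff_surjective_of_finrank_eq_finrank (Subspace.dual_finrank_eq).symm
  rw [isIso_iff_bijective]
  exact ⟨fun h => h.1, fun h' => ⟨h', h.1 h'⟩⟩

variable [FiniteDimensional k A]

lemma isIso_coadjointDesc {L : Cowedge (dualTensorFunctor (RepFin k A))} (hL : IsColimit L) :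
    IsIso (coadjointDesc L) :=
  ((isColimitCoadjointCowedge k A).coconePointUniqueUpToIso hL).isIso_hom

end Pairing

/-! ### Comparison of the kernels of `L → L*` and of `btMap`. -/

section Braided

variable {k A : Type u} [Field k] [Ring A] [Algebra k A] [QuasiTriangularQuasiHopfAlgebra k A]

/-- Every representation is isomorphic to its double dual, since a right dual is also a left dual
in a braided category. -/
noncomputable def doubleDualIso (X : RepFin k A) : X ≅ dual (dual X) :=
  rightDualIso (BraidedCategory.exactPairing_swap X (dual X)) inferInstance

lemma monodromyCoaction_apply (U V : RepFin k A) (x : Module.Dual k U.V ⊗[k] U.V) :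
    (monodromyCoaction U V).toLin x = coevalAct V.ρ (btMap k A (matrixCoeff U.ρ x)) := by
  let F : Module.Dual k U.V ⊗[k] U.V →ₗ[k] V.V ⊗[k] Module.Dual k V.V :=
    (monodromyCoaction U V).toLin
  change F x = _
  have h : F = coevalAct V.ρ ∘ₗ btMap k A ∘ₗ matrixCoeff U.ρ :=
    TensorProduct.ext' fun f u => coaction_tmul U.ρ V.ρ f u
  rw [h]; rfl

lemma comp_monodromyCoaction_eq_zero_iff {N U : RepFin k A} (V : RepFin k A)
    (j : N ⟶ Uᘁ ⊗ U) : j ≫ monodromyCoaction U V = 0 ↔ j ▷ V ≫ monodromyAction U V = 0 := by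
  rw [← tensorRightHomEquiv_monodromyAction, comp_tensorRightHomEquiv,
    tensorRightHomEquiv_eq_zero_iff]

/-- The pairing is the action on `V*` followed by `ev_V`, and evaluation detects zero morphisms into
`V*`. -/
lemma whiskerRight_doubleBraidingPairing_eq_zero_iff {N U : RepFin k A} (V : RepFin k A)
    (j : N ⟶ Uᘁ ⊗ U) :
    j ▷ (Vᘁ ⊗ V) ≫ doubleBraidingPairing U V = 0 ↔ j ▷ Vᘁ ≫ monodromyAction U Vᘁ = 0 := by
  rw [doubleBraidingPairing_eq, associator_inv_naturality_left_assoc, ← comp_whiskerRight_assoc,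
    ← comp_zero (f := (α_ N (Vᘁ : RepFin k A) V).inv), cancel_epi,
    whiskerRight_comp_evaluation_eq_zero_iff]

variable [FiniteDimensional k A] {L : Cowedge (dualTensorFunctor (RepFin k A))}

lemma whiskerRight_coendPairing_eq_zero_iff (hL : IsColimit L) {ω : L.pt ⊗ L.pt ⟶ 𝟙_ (RepFin k A)}
    (hω : IsCoendPairing L ω) {N U : RepFin k A} (j : N ⟶ Uᘁ ⊗ U) :
    (j ≫ iota L U) ▷ L.pt ≫ ω = 0 ↔
      ∀ V : RepFin k A, j ▷ (Vᘁ ⊗ V) ≫ doubleBraidingPairing U V = 0 := by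
  have h : ∀ V : RepFin k A, j ▷ (Vᘁ ⊗ V) ≫ doubleBraidingPairing U V =
      N ◁ iota L V ≫ (j ≫ iota L U) ▷ L.pt ≫ ω := by
    intro V
    rw [← hω U V, MonoidalCategory.tensorHom_def, comp_whiskerRight_assoc,
      whisker_exchange_assoc, Category.assoc, ← whisker_exchange_assoc]
  refine ⟨fun h₀ V => by rw [h, h₀, comp_zero], fun h₀ => hom_ext_tmul fun n l => ?_⟩
  have := isIso_coadjointDesc hL
  obtain ⟨φ, rfl⟩ := ((isIso_iff_bijective _).1 this).2 l
  -- Every vector of `L` has the form `ι_A(φ ⊗ 1)`, so the case `V = A` already suffices here.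
  have h₁ := h (regular k A)
  rw [h₀] at h₁
  exact (congrArg (fun g => g.toLin (n ⊗ₜ[k] ((show Module.Dual k A from φ) ⊗ₜ[k] (1 : A))))
    h₁).symm

lemma comp_coendPairingToDual_eq_zero_iff (hL : IsColimit L)
    {ω : L.pt ⊗ L.pt ⟶ 𝟙_ (RepFin k A)} (hω : IsCoendPairing L ω) {N U : RepFin k A}
    (j : N ⟶ Uᘁ ⊗ U) :
    j ≫ iota L U ≫ pairingToDual ω = 0 ↔ ∀ V : RepFin k A, j ≫ monodromyCoaction U Vᘁ = 0 := by
  rw [← Category.assoc, comp_pairingToDual_eq_zero_iff,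
    whiskerRight_coendPairing_eq_zero_iff hL hω]
  simp only [whiskerRight_doubleBraidingPairing_eq_zero_iff, comp_monodromyCoaction_eq_zero_iff]

lemma monodromyCoaction_regular_eq_zero_iff (V : RepFin k A) (x : Module.Dual k A ⊗[k] A) :
    (monodromyCoaction (regular k A) V).toLin x = 0 ↔
      V.ρ (btMap k A (matrixCoeff (Algebra.lmul k A) x)) = 0 := by
  rw [← coevalAct_eq_zero_iff]
  exact (monodromyCoaction_apply (regular k A) V x).congr_left

/-- Faithfulness of the regular representation makes the coaction at `A` control all others. -/
lemma monodromyCoaction_regular_eq_zero (V : RepFin k A) (x : Module.Dual k A ⊗[k] A)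
    (h : (monodromyCoaction (regular k A) (regular k A)).toLin x = 0) :
    (monodromyCoaction (regular k A) V).toLin x = 0 := by
  rw [monodromyCoaction_regular_eq_zero_iff] at h ⊢
  rw [(regular_rho_eq_zero_iff _).1 h, map_zero]

/-- The kernel criterion involves only duals `V*`, so a faithful dual is needed. Faithfulness of
`A*` would amount to injectivity of `S`; `A**` is faithful because the braiding gives `A ≅ A**`. -/
lemma rho_doubleDual_regular_eq_zero_iff (a : A) :
    (dual (dual (regular k A))).ρ a = 0 ↔ a = 0 := by
  constructor
  · intro h
    let e := doubleDualIso (regular k A)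
    rw [← regular_rho_eq_zero_iff (k := k)]
    have he := ((isIso_iff_bijective e.hom).1 (Iso.isIso_hom e)).1
    refine LinearMap.ext fun b => he ?_
    rw [e.hom.comm, h]
    exact (map_zero e.hom.toLin).symm
  · rintro rfl
    exact map_zero _

lemma iota_pairingToDual_eq_zero_iff (hL : IsColimit L)
    {ω : L.pt ⊗ L.pt ⟶ 𝟙_ (RepFin k A)} (hω : IsCoendPairing L ω)
    (x : Module.Dual k A ⊗[k] A) :
    (pairingToDual ω).toLin ((iota L (regular k A)).toLin x) = 0 ↔
      btMap k A (matrixCoeff (Algebra.lmul k A) x) = 0 := by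
  constructor
  · intro h
    -- The criterion is applied to the inclusion of the kernel of `A* ⊗ A → L*`, with `V = A*`, so
    -- that `V* = A**` is faithful.
    have h₁ := apply_eq_zero_of_comp (iota L (regular k A) ≫ pairingToDual ω)
      (monodromyCoaction (regular k A) (dual (dual (regular k A))))
      ((comp_coendPairingToDual_eq_zero_iff hL hω _).1 (kernelIncl_comp _) _) h
    rwa [← rho_doubleDual_regular_eq_zero_iff (k := k), ← monodromyCoaction_regular_eq_zero_iff]
  · intro h
    -- On the kernel of the coaction at `A`, the coactions at all `V*` vanish, hence so does the map
    -- to `L*`.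
    refine apply_eq_zero_of_comp (monodromyCoaction (regular k A) (regular k A))
      (iota L (regular k A) ≫ pairingToDual ω)
      ((comp_coendPairingToDual_eq_zero_iff hL hω _).2 fun V => hom_ext fun y => ?_) ?_
    · exact monodromyCoaction_regular_eq_zero Vᘁ y.1 y.2
    · exact (monodromyCoaction_regular_eq_zero_iff _ _).2 ((regular_rho_eq_zero_iff _).2 h)

lemma isIso_pairingToDual_iff (hL : IsColimit L)
    {ω : L.pt ⊗ L.pt ⟶ 𝟙_ (RepFin k A)} (hω : IsCoendPairing L ω) :
    IsIso (pairingToDual ω) ↔ Function.Bijective (btMap k A) := by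
  have hbt : Function.Injective (btMap k A) ↔ Function.Surjective (btMap k A) :=
    LinearMap.injective_iff_surjective_of_finrank_eq_finrank Subspace.dual_finrank_eq
  have hd := (isIso_iff_bijective _).1 (isIso_coadjointDesc hL)
  rw [isIso_iff_injective_of_dual, Function.Bijective, ← hbt, and_self]
  have key : ∀ φ : Module.Dual k A,
      (pairingToDual ω).toLin ((coadjointDesc L).toLin φ) = 0 ↔ btMap k A φ = 0 := by
    intro φ
    have h := iota_pairingToDual_eq_zero_iff hL hω (φ ⊗ₜ 1)
    rwa [matrixCoeff_regular_tmul_one] at h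
  rw [injective_iff_map_eq_zero, injective_iff_map_eq_zero]
  constructor
  · intro h φ hφ
    exact hd.1 ((h _ ((key φ).2 hφ)).trans (map_zero _).symm)
  · intro h l hl
    obtain ⟨φ, rfl⟩ := hd.2 l
    have h₁ : (φ : Module.Dual k A) = 0 := h φ ((key φ).1 hl)
    rw [h₁]
    exact map_zero _

lemma doubleBraidingPairing_tmul_left (U V : RepFin k A) (x : Module.Dual k U.V ⊗[k] U.V)
    (y : Module.Dual k V.V ⊗[k] V.V) :
    (doubleBraidingPairing U V).toLin (x ⊗ₜ[k] y) =
      (doubleBraidingPairing (regular k A) V).toLin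
        ((matrixCoeff U.ρ x ⊗ₜ[k] (1 : A)) ⊗ₜ[k] y) := by
  let F : (Module.Dual k U.V ⊗[k] U.V) ⊗[k] (Module.Dual k V.V ⊗[k] V.V) →ₗ[k] k :=
    (doubleBraidingPairing U V).toLin
  let G : (Module.Dual k A ⊗[k] A) ⊗[k] (Module.Dual k V.V ⊗[k] V.V) →ₗ[k] k :=
    (doubleBraidingPairing (regular k A) V).toLin
  have key : F (x ⊗ₜ[k] y) = G ((matrixCoeff U.ρ x ⊗ₜ[k] (1 : A)) ⊗ₜ[k] y) := by
    induction x with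
    | zero => simp
    | add x x' h h' => simp only [TensorProduct.add_tmul, map_add, h, h']
    | tmul f u =>
      -- As for the coend: dinaturality for `A → U`, `a ↦ a u`, moves the first argument to the
      -- regular representation.
      have h : G ((((orbitHom U u)ᘁ).toLin f ⊗ₜ[k] (1 : A)) ⊗ₜ[k] y) =
          F ((f ⊗ₜ[k] (orbitHom U u).toLin (1 : A)) ⊗ₜ[k] y) :=
        congrArg (fun g => g.toLin ((f ⊗ₜ[k] (1 : A)) ⊗ₜ[k] y))
          (doubleBraidingPairing_dinatural_left (orbitHom U u) V)
      rw [orbitHom_one, rightAdjointMate_toLin] at h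
      exact h.symm
  exact key

lemma doubleBraidingPairing_tmul_right (U V : RepFin k A) (x : Module.Dual k U.V ⊗[k] U.V)
    (y : Module.Dual k V.V ⊗[k] V.V) :
    (doubleBraidingPairing U V).toLin (x ⊗ₜ[k] y) =
      (doubleBraidingPairing U (regular k A)).toLin
        (x ⊗ₜ[k] (matrixCoeff V.ρ y ⊗ₜ[k] (1 : A))) := by
  let F : (Module.Dual k U.V ⊗[k] U.V) ⊗[k] (Module.Dual k V.V ⊗[k] V.V) →ₗ[k] k :=
    (doubleBraidingPairing U V).toLin
  let G : (Module.Dual k U.V ⊗[k] U.V) ⊗[k] (Module.Dual k A ⊗[k] A) →ₗ[k] k :=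
    (doubleBraidingPairing U (regular k A)).toLin
  have key : F (x ⊗ₜ[k] y) = G (x ⊗ₜ[k] (matrixCoeff V.ρ y ⊗ₜ[k] (1 : A))) := by
    induction y with
    | zero => simp
    | add y y' h h' => simp only [TensorProduct.tmul_add, TensorProduct.add_tmul, map_add, h, h']
    | tmul f v =>
      have h : G (x ⊗ₜ[k] (((orbitHom V v)ᘁ).toLin f ⊗ₜ[k] (1 : A))) =
          F (x ⊗ₜ[k] (f ⊗ₜ[k] (orbitHom V v).toLin (1 : A))) :=
        congrArg (fun g => g.toLin (x ⊗ₜ[k] (f ⊗ₜ[k] (1 : A))))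
          (doubleBraidingPairing_dinatural_right U (orbitHom V v))
      rw [orbitHom_one, rightAdjointMate_toLin] at h
      exact h.symm
  exact key

/-- The double braiding pairing depends only on the matrix coefficients of its arguments. -/
lemma doubleBraidingPairing_tmul (U V : RepFin k A) (x : Module.Dual k U.V ⊗[k] U.V)
    (y : Module.Dual k V.V ⊗[k] V.V) :
    (doubleBraidingPairing U V).toLin (x ⊗ₜ[k] y) =
      (doubleBraidingPairing (regular k A) (regular k A)).toLin
        ((matrixCoeff U.ρ x ⊗ₜ[k] (1 : A)) ⊗ₜ[k] (matrixCoeff V.ρ y ⊗ₜ[k] (1 : A))) :=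
  (doubleBraidingPairing_tmul_left U V x y).trans
    (doubleBraidingPairing_tmul_right (regular k A) V _ y)

variable (k A) in
/-- The canonical pairing of the coadjoint representation with itself. -/
noncomputable def coadjointPairing : coadjoint k A ⊗ coadjoint k A ⟶ 𝟙_ (RepFin k A) where
  toLin := (doubleBraidingPairing (regular k A) (regular k A)).toLin ∘ₗ
    TensorProduct.map ((TensorProduct.mk k (Module.Dual k A) A).flip 1)
      ((TensorProduct.mk k (Module.Dual k A) A).flip 1)
  comm a x := by
    -- `s` is only a linear section of the matrix coefficient morphism `M`. Since `F` factors
    -- through `M ⊗ M`, the `A`-linearity of `F` and of `M ⊗ M` passes to `F ∘ (s ⊗ s)`.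
    let s := (TensorProduct.mk k (Module.Dual k A) A).flip 1
    let c := matrixCoeffHom (regular k A) ⊗ₘ matrixCoeffHom (regular k A)
    let P := doubleBraidingPairing (regular k A) (regular k A)
    let F : (Module.Dual k A ⊗[k] A) ⊗[k] (Module.Dual k A ⊗[k] A) →ₗ[k] k := P.toLin
    let M := matrixCoeff (Algebra.lmul k A)
    have h₁ : F ∘ₗ TensorProduct.map s s ∘ₗ TensorProduct.map M M = F :=
      TensorProduct.ext' fun y z =>
        (doubleBraidingPairing_tmul (regular k A) (regular k A) y z).symm
    have h₂ : TensorProduct.map M M ∘ₗ TensorProduct.map s s = LinearMap.id :=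
      TensorProduct.ext' fun φ ψ =>
        congrArg₂ (fun φ ψ => φ ⊗ₜ[k] ψ) (matrixCoeff_regular_tmul_one φ)
          (matrixCoeff_regular_tmul_one ψ)
    let z := TensorProduct.map s s x
    have hz : x = c.toLin z := (LinearMap.congr_fun h₂ x).symm
    have h₃ : F (TensorProduct.map s s ((coadjoint k A ⊗ coadjoint k A).ρ a x)) =
        F ((((regular k A)ᘁ ⊗ regular k A) ⊗ ((regular k A)ᘁ ⊗ regular k A)).ρ a z) := by
      rw [hz]
      exact (congrArg (fun y => F (TensorProduct.map s s y)) (c.comm a z).symm).trans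
        (LinearMap.congr_fun h₁ _)
    exact h₃.trans (P.comm a z)

lemma isCoendPairing_coadjointPairing :
    IsCoendPairing (coadjointCowedge k A) (coadjointPairing k A) := fun U V =>
  hom_ext_tmul fun x y => (doubleBraidingPairing_tmul U V x y).symm

end Braided

end RepFin

end QuasiHopf

theorem corollary6p7 {k A : Type u} [Field k] [Ring A] [Algebra k A] [FiniteDimensional k A]
    [QuasiHopf.QuasiTriangularQuasiHopfAlgebra k A] :
    Function.Bijective (QuasiHopf.btMap k A) ↔
      QuasiHopf.IsFactorisable (QuasiHopf.RepFin k A) := by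
  constructor
  · intro h
    -- Existence is witnessed by `A*` with its canonical pairing; the converse must treat an
    -- arbitrary coend.
    exact ⟨_, _, ⟨QuasiHopf.RepFin.isColimitCoadjointCowedge k A⟩,
      QuasiHopf.RepFin.isCoendPairing_coadjointPairing,
      (QuasiHopf.RepFin.isIso_pairingToDual_iff
        (QuasiHopf.RepFin.isColimitCoadjointCowedge k A)
        QuasiHopf.RepFin.isCoendPairing_coadjointPairing).2 h⟩
  · rintro ⟨L, ω, ⟨hL⟩, hω, h⟩
    exact (QuasiHopf.RepFin.isIso_pairingToDual_iff hL hω).1 h
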